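/- **Setting.** Let $\{Z_t\}_{t\ge0}$ be a time-homogeneous Markov chain on $\mathsf Z=\{1,\dots,Z\}$ with transition probability matrix $P$, let $\{\varepsilon_t\},\{\zeta_t\},\{\eta_t\}$ be innovation processes that are i.i.d. over time, mutually independent and independent of the chain, and let $\beta_t=\beta(Z_t,\varepsilon_t)$, $R_t=R(Z_t,\zeta_t)$, $Y_t=Y(Z_t,\eta_t)$ for $t\ge1$, where $\beta,R,Y$ are nonnegative measurable functions; put $\beta_0=1$. Given initial wealth $a_0=a>0$ and state $Z_0=z$, the income fluctuation problem is to maximize $\mathrm E_z\sum_{t=0}^\infty\bigl(\prod_{i=0}^t\beta_i\bigr)u(c_t)$ over consumption plans $\{c_t\}$ adapted to the shocks, subject to $a_{t+1}=R_{t+1}(a_t-c_t)+Y_{t+1}$ and $0\le c_t\le a_t$. A measurable function $c(a,z)$ with $0\le c(a,z)\le a$ is the consumption function if $c_t=c(a_t,Z_t)$ solves this problem for all initial $(a,z)$ with $a>0$. For a function $X$ of the state and the innovations write $\mathrm E_zX=\mathrm E[X\mid Z=z]$ and let $D_X$ be the diagonal matrix with entries $\mathrm E_zX$, $z\in\mathsf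 Z$; $r(\cdot)$ is the spectral radius. By convention $\beta R^{1-\gamma}=(\beta R)R^{-\gamma}$, which is $0$ if $\beta=0$ or $R=0$. **Assumptions.** 1. $u:[0,\infty)\to\mathbb R\cup\{-\infty\}$ is increasing, is twice continuously differentiable on $(0,\infty)$, and satisfies $u'>0$, $u''<0$ on $(0,\infty)$, $u'(0)=\lim_{c\downarrow0}u'(c)=\infty$ and $u'(\infty)=\lim_{c\to\infty}u'(c)<1$. 2. $\mathrm E_z\beta<\infty$, $\mathrm E_z\beta R<\infty$, $\mathrm E_zY<\infty$ and $\mathrm E_zu'(Y)<\infty$ for all $z$; $r(PD_\beta)<1$ and $r(PD_{\beta R})<1$. 3. For some $\gamma>0$, $u'$ is regularly varying with index $-\gamma$: $u'(\lambda c)/u'(c)\to\lambda^{-\gamma}$ as $c\to\infty$ for every $\lambda>0$. 4. There is $\delta>0$ such that $R\in\{0\}\cup[\delta,\infty)$ almost surely (for every state). **Theorem (Asymptotic linearity).** Under Assumptions 1–4, $\mathrm E_z\beta R^{1-\gamma}<\infty$ for all $z$. Let $D=D_{\beta R^{1-\gamma}}$ and define $F:\mathbb R_+^Z\to\mathbb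 R_+^Z$ by $(Fx)(z)=\bigl(1+(PDx)(z)^{1/\gamma}\bigr)^\gamma$. Then $F$ has a fixed point $x^*\in\mathbb R_+^Z$ if and only if $r(PD)<1$, in which case it is unique. Furthermore, let $c(a,z)$ be the consumption function. (i) If $r(PD)<1$, then for all $z$ $$0\le\liminf_{a\to\infty}\frac{c(a,z)}a\le\limsup_{a\to\infty}\frac{c(a,z)}a\le x^*(z)^{-1/\gamma}.$$ If moreover $\liminf_{a\to\infty}c(a,z)/a>0$ for all $z$, then $\lim_{a\to\infty}c(a,z)/a=x^*(z)^{-1/\gamma}\in(0,1]$ for all $z$. (ii) If $r(PD)\ge1$ and $PD$ is irreducible, then $\lim_{a\to\infty}c(a,z)/a=0$ for all $z$. -/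

import Mathlib

open MeasureTheory ProbabilityTheory Filter Topology
open scoped ENNReal

noncomputable section

namespace IncomeFluctuation

/-- Primitives of the income fluctuation problem, apart from utility: a transition probability
matrix `P` on the states `Fin n`, the laws of the three (mutually independent, i.i.d. over time)
innovations, and the nonnegative measurable functions giving the discount factor
`β(z, ε)`, the gross return `R(z, ζ)` and the non-financial income `Y(z, η)`. -/
structure Model (n : ℕ) (E₁ E₂ E₃ : Type*)
    [MeasurableSpace E₁] [MeasurableSpace E₂] [MeasurableSpace E₃] where
  P : Matrix (Fin n) (Fin n) ℝ
  P_mem : P ∈ Matrix.rowStochastic ℝ (Fin n)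
  lawε : Measure E₁
  lawζ : Measure E₂
  lawη : Measure E₃
  isProb_ε : IsProbabilityMeasure lawε
  isProb_ζ : IsProbabilityMeasure lawζ
  isProb_η : IsProbabilityMeasure lawη
  β : Fin n → E₁ → ℝ
  R : Fin n → E₂ → ℝ
  Y : Fin n → E₃ → ℝ
  measurable_β : ∀ z, Measurable (β z)
  measurable_R : ∀ z, Measurable (R z)
  measurable_Y : ∀ z, Measurable (Y z)
  β_nonneg : ∀ z e, 0 ≤ β z e
  R_nonneg : ∀ z e, 0 ≤ R z e
  Y_nonneg : ∀ z e, 0 ≤ Y z e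

attribute [instance] Model.isProb_ε Model.isProb_ζ Model.isProb_η

/-- The exogenous variables `(Z_t, (ε_t, ζ_t, η_t))` of one period. -/
abbrev Shock (n : ℕ) (E₁ E₂ E₃ : Type*) : Type _ := Fin n × (E₁ × E₂ × E₃)

/-- Realizations of the exogenous process `(Z_t, ε_t, ζ_t, η_t)`, `t = 0, 1, 2, …`. -/
abbrev Path (n : ℕ) (E₁ E₂ E₃ : Type*) : Type _ := ℕ → Shock n E₁ E₂ E₃

variable {n : ℕ} {E₁ E₂ E₃ : Type*}
  [MeasurableSpace E₁] [MeasurableSpace E₂] [MeasurableSpace E₃]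

namespace Model

variable (M : Model n E₁ E₂ E₃)

/-- Joint law of one period's innovations. -/
def lawInnov : Measure (E₁ × E₂ × E₃) := M.lawε.prod (M.lawζ.prod M.lawη)

instance : IsProbabilityMeasure M.lawInnov := by
  unfold lawInnov; infer_instance

/-- The law `P(z, ·)` of next period's state. -/
def row (z : Fin n) : Measure (Fin n) :=
  ∑ z' : Fin n, ENNReal.ofReal (M.P z z') • Measure.dirac z'

instance (z : Fin n) : IsProbabilityMeasure (M.row z) := by
  constructor
  have h0 : ∀ i j, 0 ≤ M.P i j := M.P_mem.1
  have h1 : ∑ j, M.P z j = 1 := by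
    have h := congrFun M.P_mem.2 z
    simpa [Matrix.mulVec, dotProduct] using h
  simp [row, ← ENNReal.ofReal_sum_of_nonneg (fun j _ => h0 z j), h1]

/-- Given today's shock with state `z`, tomorrow's state has law `P(z, ·)` and tomorrow's
innovations are drawn afresh. -/
def step : Kernel (Shock n E₁ E₂ E₃) (Shock n E₁ E₂ E₃) :=
  (Kernel.ofFunOfCountable fun z : Fin n => (M.row z).prod M.lawInnov).comap Prod.fst
    measurable_fst

instance : IsMarkovKernel M.step := by
  constructor
  intro x
  change IsProbabilityMeasure ((M.row x.1).prod M.lawInnov)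
  infer_instance

/-- The kernel from the history up to date `t` to the shock of date `t + 1`. -/
def histKernel (t : ℕ) :
    Kernel ((i : Finset.Iic t) → (fun _ : ℕ => Shock n E₁ E₂ E₃) i) (Shock n E₁ E₂ E₃) :=
  M.step.comap (fun h => h ⟨t, Finset.mem_Iic.2 le_rfl⟩) (measurable_pi_apply _)

instance (t : ℕ) : IsMarkovKernel (M.histKernel t) := by
  unfold histKernel; infer_instance

/-- The law of the exogenous process when `Z_0 = z`. -/
def law (z : Fin n) : Measure (Path n E₁ E₂ E₃) :=
  Kernel.trajMeasure (X := fun _ : ℕ => Shock n E₁ E₂ E₃)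
    ((Measure.dirac z).prod M.lawInnov) M.histKernel

/-- `β_t`, `R_t`, `Y_t` along a path; they are used for `t ≥ 1` only. -/
def βAt (t : ℕ) (ω : Path n E₁ E₂ E₃) : ℝ := M.β (ω t).1 (ω t).2.1

def RAt (t : ℕ) (ω : Path n E₁ E₂ E₃) : ℝ := M.R (ω t).1 (ω t).2.2.1

def YAt (t : ℕ) (ω : Path n E₁ E₂ E₃) : ℝ := M.Y (ω t).1 (ω t).2.2.2

/-- `β_0 β_1 ⋯ β_t` with the normalization `β_0 = 1`. -/
def discount (t : ℕ) (ω : Path n E₁ E₂ E₃) : ℝ := ∏ i ∈ Finset.range t, M.βAt (i + 1) ω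

/-- Wealth `a_t` when initial wealth is `a` and consumption is `C_0, C_1, …`. -/
def wealth (a : ℝ) (C : ℕ → Path n E₁ E₂ E₃ → ℝ) : ℕ → Path n E₁ E₂ E₃ → ℝ
  | 0, _ => a
  | t + 1, ω => M.RAt (t + 1) ω * (wealth a C t ω - C t ω) + M.YAt (t + 1) ω

/-- A consumption plan is feasible from wealth `a` if `C_t` depends (measurably) only on the
shocks up to date `t` and `0 ≤ C_t ≤ a_t`. -/
structure IsFeasible (a : ℝ) (C : ℕ → Path n E₁ E₂ E₃ → ℝ) : Prop where
  adapted : ∀ t, Measurable[Filtration.piLE (X := fun _ : ℕ => Shock n E₁ E₂ E₃) t] (C t)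
  nonneg : ∀ t ω, 0 ≤ C t ω
  le_wealth : ∀ t ω, C t ω ≤ M.wealth a C t ω

/-- Expected lifetime utility `E_z ∑_t β_0 ⋯ β_t u(C_t)`, written as the expected sum of positive
parts minus the expected sum of negative parts (and `0 · ∞ = 0`). -/
def lifetimeUtility (u : ℝ → EReal) (z : Fin n) (C : ℕ → Path n E₁ E₂ E₃ → ℝ) : EReal :=
  ((∫⁻ ω, ∑' t, ENNReal.ofReal (M.discount t ω) * (u (C t ω)).toENNReal ∂(M.law z) : ℝ≥0∞) : EReal)
  - ((∫⁻ ω, ∑' t, ENNReal.ofReal (M.discount t ω) * (-u (C t ω)).toENNReal ∂(M.law z) : ℝ≥0∞) :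
      EReal)

/-- The plan `C` solves the income fluctuation problem with initial wealth `a` and state `z`. -/
def IsSolution (u : ℝ → EReal) (a : ℝ) (z : Fin n) (C : ℕ → Path n E₁ E₂ E₃ → ℝ) : Prop :=
  M.IsFeasible a C ∧ ∀ C', M.IsFeasible a C' → M.lifetimeUtility u z C' ≤ M.lifetimeUtility u z C

/-- Wealth at date `t` when consumption is given by the policy `c`, i.e. `C_t = c(a_t, Z_t)`. -/
def policyWealth (c : ℝ → Fin n → ℝ) (a : ℝ) : ℕ → Path n E₁ E₂ E₃ → ℝ
  | 0, _ => a
  | t + 1, ω =>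
    M.RAt (t + 1) ω * (policyWealth c a t ω - c (policyWealth c a t ω) (ω t).1) + M.YAt (t + 1) ω

/-- The consumption plan `C_t = c(a_t, Z_t)` generated by the policy `c`. -/
def policyPlan (c : ℝ → Fin n → ℝ) (a : ℝ) (t : ℕ) (ω : Path n E₁ E₂ E₃) : ℝ :=
  c (M.policyWealth c a t ω) (ω t).1

/-- `c(a, z)` is the consumption function of the income fluctuation problem: a measurable policy
with `0 ≤ c(a, z) ≤ a` that generates a solution from each initial wealth `a > 0` and each
initial state `z`. -/
structure IsConsumptionFunction (u : ℝ → EReal) (c : ℝ → Fin n → ℝ) : Prop where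
  measurable : ∀ z, Measurable fun a => c a z
  nonneg : ∀ a, 0 ≤ a → ∀ z, 0 ≤ c a z
  le_self : ∀ a, 0 ≤ a → ∀ z, c a z ≤ a
  optimal : ∀ a, 0 < a → ∀ z, M.IsSolution u a z (M.policyPlan c a)

/-- `E_z X` for a function `X` of the state and the innovations. -/
def condMean (X : Fin n → E₁ × E₂ × E₃ → ℝ) (z : Fin n) : ℝ := ∫ e, X z e ∂M.lawInnov

/-- `E_z |X| < ∞`. -/
def FiniteMean (X : Fin n → E₁ × E₂ × E₃ → ℝ) (z : Fin n) : Prop := Integrable (X z) M.lawInnov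

/-- The diagonal matrix `D_X` with entries `E_z X`. -/
def diag (X : Fin n → E₁ × E₂ × E₃ → ℝ) : Matrix (Fin n) (Fin n) ℝ :=
  Matrix.diagonal (M.condMean X)

/-- The variables `β`, `βR`, `βR^{1-γ} = (βR)R^{-γ}` and `Y` as functions of state and innovations.
For `γ > 0` the third one is `0` where `R = 0`, as `Real.rpow` gives `0 ^ (-γ) = 0`. -/
def varβ (z : Fin n) (e : E₁ × E₂ × E₃) : ℝ := M.β z e.1

def varβR (z : Fin n) (e : E₁ × E₂ × E₃) : ℝ := M.β z e.1 * M.R z e.2.1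

def varβRγ (γ : ℝ) (z : Fin n) (e : E₁ × E₂ × E₃) : ℝ :=
  (M.β z e.1 * M.R z e.2.1) * M.R z e.2.1 ^ (-γ)

def varY (z : Fin n) (e : E₁ × E₂ × E₃) : ℝ := M.Y z e.2.2

end Model

/-- The largest absolute value of all (complex) eigenvalues of a real square matrix. -/
def specRad (A : Matrix (Fin n) (Fin n) ℝ) : ℝ≥0∞ :=
  spectralRadius ℂ (A.map (algebraMap ℝ ℂ))

/-- Marginal utility `u'` on `(0, ∞)`. -/
def marginal (u : ℝ → EReal) (c : ℝ) : ℝ := deriv (fun x => (u x).toReal) c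

/-- Marginal utility on `[0, ∞)` with `u'(0) = ∞`. -/
def marginalExt (u : ℝ → EReal) (c : ℝ) : ℝ≥0∞ :=
  if 0 < c then ENNReal.ofReal (marginal u c) else ⊤

/-- Assumptions on `u : [0, ∞) → ℝ ∪ {-∞}` (its values at negative numbers are irrelevant). -/
structure IsInadaUtility (u : ℝ → EReal) : Prop where
  ne_bot : ∀ c, 0 < c → u c ≠ ⊥
  ne_top : ∀ c, 0 < c → u c ≠ ⊤
  zero_le : ∀ c, 0 < c → u 0 ≤ u c
  contDiffOn : ContDiffOn ℝ 2 (fun x => (u x).toReal) (Set.Ioi 0)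
  marginal_pos : ∀ c, 0 < c → 0 < marginal u c
  deriv_marginal_neg : ∀ c, 0 < c → deriv (marginal u) c < 0
  marginal_zero : Tendsto (marginal u) (𝓝[>] 0) atTop
  marginal_infty : ∃ L < 1, Tendsto (marginal u) atTop (𝓝 L)

/-- The spectral and integrability conditions. -/
structure SpectralConditions (M : Model n E₁ E₂ E₃) (u : ℝ → EReal) : Prop where
  finite_β : ∀ z, M.FiniteMean M.varβ z
  finite_βR : ∀ z, M.FiniteMean M.varβR z
  specRad_β : specRad (M.P * M.diag M.varβ) < 1
  specRad_βR : specRad (M.P * M.diag M.varβR) < 1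
  finite_Y : ∀ z, M.FiniteMean M.varY z
  finite_marginal_Y : ∀ z, ∫⁻ e, marginalExt u (M.varY z e) ∂M.lawInnov < ⊤

/-- `f : (0, ∞) → (0, ∞)` is regularly varying (at infinity) with index `ρ`. -/
structure IsRegularlyVarying (f : ℝ → ℝ) (ρ : ℝ) : Prop where
  measurable : Measurable fun x : Set.Ioi (0 : ℝ) => f x
  pos : ∀ x, 0 < x → 0 < f x
  tendsto : ∀ l : ℝ, 0 < l → Tendsto (fun x => f (l * x) / f x) atTop (𝓝 (l ^ ρ))

/-- `R ∈ {0} ∪ [δ, ∞)` almost surely for some `δ > 0`. -/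
def ReturnZeroOrBoundedBelow (M : Model n E₁ E₂ E₃) : Prop :=
  ∃ δ : ℝ, 0 < δ ∧ ∀ z, ∀ᵐ e ∂M.lawζ, M.R z e = 0 ∨ δ ≤ M.R z e

/-- The matrix `PD` with `D = D_{βR^{1-γ}}`. -/
def matPD (M : Model n E₁ E₂ E₃) (γ : ℝ) : Matrix (Fin n) (Fin n) ℝ :=
  M.P * M.diag (M.varβRγ γ)

/-- `(Fx)(z) = (1 + (PDx)(z)^{1/γ})^γ`. -/
def mapF (M : Model n E₁ E₂ E₃) (γ : ℝ) (x : Fin n → ℝ) : Fin n → ℝ :=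
  fun z => (1 + (matPD M γ).mulVec x z ^ (1 / γ)) ^ γ

/-- `x ∈ ℝ₊^Z` and `Fx = x`. -/
def IsFixedPointF (M : Model n E₁ E₂ E₃) (γ : ℝ) (x : Fin n → ℝ) : Prop :=
  (∀ z, 0 ≤ x z) ∧ mapF M γ x = x

end IncomeFluctuation

end

noncomputable section

namespace IncomeFluctuation

section Matrices

variable {n : ℕ} {A : Matrix (Fin n) (Fin n) ℝ}

/-- Collatz–Wielandt upper bound for the spectral radius of a nonnegative matrix. -/
lemma specRad_le_of_mulVec_le (hA : ∀ i j, 0 ≤ A i j) {x : Fin n → ℝ} (hx : ∀ i, 0 < x i)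
    {ρ : ℝ} (h : ∀ i, A.mulVec x i ≤ ρ * x i) : specRad A ≤ ENNReal.ofReal ρ := by
  refine iSup₂_le fun k hk => ?_
  rw [spectrum.mem_iff, Matrix.isUnit_iff_isUnit_det, isUnit_iff_ne_zero, not_not,
    ← Matrix.exists_mulVec_eq_zero_iff] at hk
  obtain ⟨v, hv, hkv⟩ := hk
  obtain ⟨i₀, hi₀⟩ : ∃ i, v i ≠ 0 := by
    by_contra! hcon
    exact hv (funext hcon)
  obtain ⟨i, -, hi⟩ := Finset.exists_max_image Finset.univ (fun i => ‖v i‖ / x i)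
    ⟨i₀, Finset.mem_univ _⟩
  have hm : ∀ j, ‖v j‖ ≤ ‖v i‖ / x i * x j := fun j => by
    rw [← div_le_iff₀ (hx j)]
    exact hi j (Finset.mem_univ _)
  have hvi : 0 < ‖v i‖ := by
    have h1 : 0 < ‖v i₀‖ / x i₀ := div_pos (norm_pos_iff.2 hi₀) (hx _)
    have h2 := h1.trans_le (hi i₀ (Finset.mem_univ _))
    by_contra! hcon
    exact absurd h2 (not_lt.2 (div_nonpos_of_nonpos_of_nonneg hcon (hx i).le))
  have hkvi : k * v i = ∑ j, (A i j : ℂ) * v j := by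
    have h1 := congrFun hkv i
    simp only [Matrix.sub_mulVec, Pi.sub_apply, Pi.zero_apply, sub_eq_zero] at h1
    rw [Algebra.algebraMap_eq_smul_one, Matrix.smul_mulVec, Matrix.one_mulVec] at h1
    simpa [Matrix.mulVec, dotProduct] using h1
  have hle : ‖k‖ * ‖v i‖ ≤ ρ * ‖v i‖ := by
    calc ‖k‖ * ‖v i‖ = ‖∑ j, (A i j : ℂ) * v j‖ := by rw [← norm_mul, hkvi]
      _ ≤ ∑ j, A i j * ‖v j‖ := by
        refine (norm_sum_le _ _).trans (Finset.sum_le_sum fun j _ => ?_)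
        rw [norm_mul, Complex.norm_real, Real.norm_of_nonneg (hA i j)]
      _ ≤ ∑ j, A i j * (‖v i‖ / x i * x j) :=
        Finset.sum_le_sum fun j _ => mul_le_mul_of_nonneg_left (hm j) (hA i j)
      _ = ‖v i‖ / x i * A.mulVec x i := by
        simp only [Matrix.mulVec, dotProduct, Finset.mul_sum]
        exact Finset.sum_congr rfl fun j _ => by ring
      _ ≤ ‖v i‖ / x i * (ρ * x i) :=
        mul_le_mul_of_nonneg_left (h i) (div_nonneg hvi.le (hx i).le)
      _ = ρ * ‖v i‖ := by
        have := (hx i).ne'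
        field_simp
  have hk2 : ‖k‖ ≤ ρ := le_of_mul_le_mul_right hle hvi
  rw [← enorm_eq_nnnorm, ← ofReal_norm]
  exact ENNReal.ofReal_le_ofReal hk2

lemma specRad_lt_one_of_mulVec_lt (hA : ∀ i j, 0 ≤ A i j) {x : Fin n → ℝ} (hx : ∀ i, 0 < x i)
    (h : ∀ i, A.mulVec x i < x i) : specRad A < 1 := by
  obtain ⟨ρ, hρ, hle⟩ : ∃ ρ < 1, ∀ i, A.mulVec x i ≤ ρ * x i := by
    rcases isEmpty_or_nonempty (Fin n) with hn | hn
    · exact ⟨0, zero_lt_one, fun i => isEmptyElim i⟩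
    · obtain ⟨i, -, hi⟩ := Finset.exists_max_image Finset.univ (fun i => A.mulVec x i / x i)
        Finset.univ_nonempty
      refine ⟨A.mulVec x i / x i, (div_lt_one (hx i)).2 (h i), fun j => ?_⟩
      rw [← div_le_iff₀ (hx j)]
      exact hi j (Finset.mem_univ _)
  refine (specRad_le_of_mulVec_le hA hx hle).trans_lt ?_
  rw [← ENNReal.ofReal_one]
  exact (ENNReal.ofReal_lt_ofReal_iff zero_lt_one).2 hρ

attribute [local instance] Matrix.linftyOpNormedRing Matrix.linftyOpNormedAlgebra in
lemma exists_rowSum_pow_le (hA : ∀ i j, 0 ≤ A i j) (h : specRad A < 1) :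
    ∃ s : ℝ, 0 < s ∧ s < 1 ∧ ∃ k : ℕ, 0 < k ∧ ∀ i, ∑ j, (A ^ k) i j ≤ s ^ k := by
  obtain ⟨s, hs1, hs2⟩ := ENNReal.lt_iff_exists_nnreal_btwn.1 h
  have hs0 : 0 < s := by
    have := (zero_le (a := specRad A)).trans_lt hs1
    exact_mod_cast this
  have hlim := spectrum.pow_nnnorm_pow_one_div_tendsto_nhds_spectralRadius
    (A.map (algebraMap ℝ ℂ))
  obtain ⟨k, hk, hk0⟩ := ((hlim.eventually_lt_const hs1).and (eventually_gt_atTop 0)).exists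
  refine ⟨s, hs0, by exact_mod_cast hs2, k, hk0, fun i => ?_⟩
  have hk0' : (0 : ℝ) < k := by exact_mod_cast hk0
  have h1 : ((‖A.map (algebraMap ℝ ℂ) ^ k‖₊ : ℝ≥0∞)) ≤ (s : ℝ≥0∞) ^ k := by
    have h2 := ENNReal.rpow_le_rpow hk.le hk0'.le
    rwa [← ENNReal.rpow_mul, one_div_mul_cancel hk0'.ne', ENNReal.rpow_one,
      ENNReal.rpow_natCast] at h2
  have h3 : ‖A.map (algebraMap ℝ ℂ) ^ k‖₊ ≤ s ^ k := by exact_mod_cast h1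
  have hmap : A.map (algebraMap ℝ ℂ) ^ k = (A ^ k).map (algebraMap ℝ ℂ) := by
    have := map_pow (algebraMap ℝ ℂ).mapMatrix A k
    simpa using this.symm
  have hpow : ∀ i j, 0 ≤ (A ^ k) i j := fun i j => Matrix.pow_apply_nonneg hA k i j
  have h4 : ∑ j, ‖(A ^ k).map (algebraMap ℝ ℂ) i j‖₊ ≤ s ^ k := by
    refine le_trans ?_ h3
    rw [hmap, Matrix.linfty_opNNNorm_def]
    exact Finset.le_sup (f := fun i => ∑ j, ‖(A ^ k).map (algebraMap ℝ ℂ) i j‖₊)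
      (Finset.mem_univ i)
  have h5 : ∑ j, ‖(A ^ k).map (algebraMap ℝ ℂ) i j‖ ≤ (s : ℝ) ^ k := by
    have := NNReal.coe_le_coe.2 h4
    push_cast at this
    exact this
  refine le_trans (le_of_eq (Finset.sum_congr rfl fun j _ => ?_)) h5
  simp [abs_of_nonneg (hpow i j)]

/-- A nonnegative matrix with spectral radius less than one contracts some positive vector. -/
lemma exists_mulVec_le_of_specRad_lt_one (hA : ∀ i j, 0 ≤ A i j) (h : specRad A < 1) :
    ∃ (ρ : ℝ) (p : Fin n → ℝ), 0 < ρ ∧ ρ < 1 ∧ (∀ i, 1 ≤ p i) ∧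
      ∀ i, A.mulVec p i ≤ ρ * p i := by
  obtain ⟨s, hs0, hs1, k, hk0, hk⟩ := exists_rowSum_pow_le hA h
  have hnn : ∀ j i, 0 ≤ s⁻¹ ^ j * ∑ l, (A ^ j) i l := fun j i =>
    mul_nonneg (by positivity) (Finset.sum_nonneg fun l _ => Matrix.pow_apply_nonneg hA j i l)
  have h0 : ∀ i, s⁻¹ ^ 0 * ∑ l, (A ^ 0) i l = 1 := fun i => by
    simp [Matrix.one_apply]
  refine ⟨s, fun i => ∑ j ∈ Finset.range k, s⁻¹ ^ j * ∑ l, (A ^ j) i l, hs0, hs1, fun i => ?_,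
    fun i => ?_⟩
  · rw [← h0 i]
    exact Finset.single_le_sum (f := fun j => s⁻¹ ^ j * ∑ l, (A ^ j) i l)
      (fun j _ => hnn j i) (Finset.mem_range.2 hk0)
  · have h1 : A.mulVec (fun i => ∑ j ∈ Finset.range k, s⁻¹ ^ j * ∑ l, (A ^ j) i l) i
        = s * ∑ j ∈ Finset.range k, s⁻¹ ^ (j + 1) * ∑ l, (A ^ (j + 1)) i l := by
      simp only [Matrix.mulVec, dotProduct, Finset.mul_sum]
      rw [Finset.sum_comm]
      refine Finset.sum_congr rfl fun j _ => ?_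
      rw [Finset.sum_comm]
      refine Finset.sum_congr rfl fun l _ => ?_
      rw [pow_succ' A, Matrix.mul_apply, Finset.mul_sum, Finset.mul_sum]
      refine Finset.sum_congr rfl fun m _ => ?_
      rw [pow_succ]
      field_simp
    rw [h1]
    refine mul_le_mul_of_nonneg_left ?_ hs0.le
    have h2 := Finset.sum_range_succ' (fun j => s⁻¹ ^ j * ∑ l, (A ^ j) i l) k
    have h3 := Finset.sum_range_succ (fun j => s⁻¹ ^ j * ∑ l, (A ^ j) i l) k
    have h4 : s⁻¹ ^ k * ∑ l, (A ^ k) i l ≤ 1 := by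
      rw [inv_pow, inv_mul_le_iff₀ (by positivity), mul_one]
      exact hk i
    rw [h0] at h2
    linarith

end Matrices

section FixedPoint

variable {γ : ℝ}

/-- The scalar map `y ↦ (1 + y^{1/γ})^γ`. -/
def aggr (γ y : ℝ) : ℝ := (1 + y ^ (1 / γ)) ^ γ

lemma aggr_mono (hγ : 0 < γ) {x y : ℝ} (hx : 0 ≤ x) (hxy : x ≤ y) : aggr γ x ≤ aggr γ y := by
  have := Real.rpow_nonneg hx (1 / γ)
  exact Real.rpow_le_rpow (by linarith)
    (by linarith [Real.rpow_le_rpow hx hxy (one_div_pos.2 hγ).le]) hγ.le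

lemma one_le_aggr (hγ : 0 < γ) {y : ℝ} (hy : 0 ≤ y) : 1 ≤ aggr γ y :=
  Real.one_le_rpow (by linarith [Real.rpow_nonneg hy (1 / γ)]) hγ.le

lemma lt_aggr (hγ : 0 < γ) {y : ℝ} (hy : 0 ≤ y) : y < aggr γ y := by
  have h0 := Real.rpow_nonneg hy (1 / γ)
  calc y = (y ^ (1 / γ)) ^ γ := by rw [← Real.rpow_mul hy, one_div_mul_cancel hγ.ne', Real.rpow_one]
    _ < aggr γ y := Real.rpow_lt_rpow h0 (by linarith) hγ

lemma mul_aggr_lt (hγ : 0 < γ) {t y : ℝ} (ht0 : 0 < t) (ht1 : t < 1) (hy : 0 ≤ y) :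
    t * aggr γ y < aggr γ (t * y) := by
  have h0 := Real.rpow_nonneg hy (1 / γ)
  have h1 : t ^ (1 / γ) < 1 := Real.rpow_lt_one ht0.le ht1 (one_div_pos.2 hγ)
  have h2 : 0 < t ^ (1 / γ) := Real.rpow_pos_of_pos ht0 _
  calc t * aggr γ y = (t ^ (1 / γ) * (1 + y ^ (1 / γ))) ^ γ := by
        rw [Real.mul_rpow h2.le (by linarith), ← Real.rpow_mul ht0.le, one_div_mul_cancel hγ.ne',
          Real.rpow_one, aggr]
    _ < aggr γ (t * y) := by
        refine Real.rpow_lt_rpow (by positivity) ?_ hγ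
        rw [Real.mul_rpow ht0.le hy]
        nlinarith

lemma aggr_mul_lt (hγ : 0 < γ) {t y : ℝ} (ht : 1 < t) (hy : 0 ≤ y) :
    aggr γ (t * y) < t * aggr γ y := by
  have ht0 : 0 < t := by linarith
  have h := mul_aggr_lt hγ (inv_pos.2 ht0) (inv_lt_one_of_one_lt₀ ht) (mul_nonneg ht0.le hy)
  rwa [inv_mul_cancel_left₀ ht0.ne', inv_mul_lt_iff₀ ht0] at h

/-- Large values are contracted by `y ↦ aggr γ (ρ y)` when `ρ < 1`. -/
lemma aggr_mul_le (hγ : 0 < γ) {ρ y : ℝ} (hρ0 : 0 < ρ) (hρ1 : ρ < 1)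
    (hy : (1 / (1 - ρ ^ (1 / γ))) ^ γ ≤ y) : aggr γ (ρ * y) ≤ y := by
  have h1 : ρ ^ (1 / γ) < 1 := Real.rpow_lt_one hρ0.le hρ1 (one_div_pos.2 hγ)
  have h2 : 0 < 1 / (1 - ρ ^ (1 / γ)) := one_div_pos.2 (by linarith)
  have hy0 : 0 < y := (Real.rpow_pos_of_pos h2 _).trans_le hy
  have h3 : 1 / (1 - ρ ^ (1 / γ)) ≤ y ^ (1 / γ) := by
    have := Real.rpow_le_rpow (Real.rpow_nonneg h2.le _) hy (one_div_pos.2 hγ).le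
    rwa [← Real.rpow_mul h2.le, mul_one_div_cancel hγ.ne', Real.rpow_one] at this
  rw [div_le_iff₀ (by linarith)] at h3
  have h5 : 0 < y ^ (1 / γ) := Real.rpow_pos_of_pos hy0 _
  have h6 : 0 < ρ ^ (1 / γ) := Real.rpow_pos_of_pos hρ0 _
  calc aggr γ (ρ * y) = (1 + ρ ^ (1 / γ) * y ^ (1 / γ)) ^ γ := by
        rw [aggr, Real.mul_rpow hρ0.le hy0.le]
    _ ≤ (y ^ (1 / γ)) ^ γ := Real.rpow_le_rpow (by positivity) (by linarith) hγ.le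
    _ = y := by rw [← Real.rpow_mul hy0.le, one_div_mul_cancel hγ.ne', Real.rpow_one]

variable {n : ℕ} {A : Matrix (Fin n) (Fin n) ℝ}

lemma mulVec_nonneg_of_nonneg (hA : ∀ i j, 0 ≤ A i j) {x : Fin n → ℝ} (hx : ∀ i, 0 ≤ x i)
    (i : Fin n) :
    0 ≤ A.mulVec x i := by
  rw [Matrix.mulVec, dotProduct]
  exact Finset.sum_nonneg fun j _ => mul_nonneg (hA i j) (hx j)

lemma mulVec_mono_of_nonneg (hA : ∀ i j, 0 ≤ A i j) {x y : Fin n → ℝ} {i : Fin n}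
    (h : ∀ j, 0 < A i j → x j ≤ y j) : A.mulVec x i ≤ A.mulVec y i := by
  rw [Matrix.mulVec, Matrix.mulVec, dotProduct, dotProduct]
  refine Finset.sum_le_sum fun j _ => ?_
  rcases (hA i j).eq_or_lt with h0 | h0
  · simp [← h0]
  · exact mul_le_mul_of_nonneg_left (h j h0) (hA i j)

lemma exists_aggr_fixedPoint (hγ : 0 < γ) (hA : ∀ i j, 0 ≤ A i j) (h : specRad A < 1) :
    ∃ x : Fin n → ℝ, (∀ i, 0 ≤ x i) ∧ ∀ i, aggr γ (A.mulVec x i) = x i := by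
  obtain ⟨ρ, p, hρ0, hρ1, hp, hAp⟩ := exists_mulVec_le_of_specRad_lt_one hA h
  set T : ℝ := (1 / (1 - ρ ^ (1 / γ))) ^ γ with hT
  have h1 : ρ ^ (1 / γ) < 1 := Real.rpow_lt_one hρ0.le hρ1 (one_div_pos.2 hγ)
  have hT0 : 0 < T := Real.rpow_pos_of_pos (one_div_pos.2 (by linarith)) _
  have hle : (0 : Fin n → ℝ) ≤ T • p := fun i => by
    have := hp i
    simp only [Pi.zero_apply, Pi.smul_apply, smul_eq_mul]
    positivity
  have hsuper : ∀ i, aggr γ (A.mulVec (T • p) i) ≤ (T • p) i := fun i => by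
    have h2 : A.mulVec (T • p) i ≤ ρ * (T * p i) := by
      rw [Matrix.mulVec_smul, Pi.smul_apply, smul_eq_mul]
      nlinarith [hAp i]
    refine (aggr_mono hγ (mulVec_nonneg_of_nonneg hA hle i) h2).trans
      (aggr_mul_le hγ hρ0 hρ1 ?_)
    rw [← hT]
    nlinarith [hp i]
  have : Fact ((0 : Fin n → ℝ) ≤ T • p) := ⟨hle⟩
  let f : Set.Icc (0 : Fin n → ℝ) (T • p) →o Set.Icc (0 : Fin n → ℝ) (T • p) :=
    { toFun := fun x => ⟨fun i => aggr γ (A.mulVec x.1 i),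
        fun i => zero_le_one.trans
          (one_le_aggr hγ (mulVec_nonneg_of_nonneg hA (fun j => x.2.1 j) i)),
        fun i => (aggr_mono hγ (mulVec_nonneg_of_nonneg hA (fun j => x.2.1 j) i)
          (mulVec_mono_of_nonneg hA fun j _ => x.2.2 j)).trans (hsuper i)⟩
      monotone' := fun x y hxy i => aggr_mono hγ
        (mulVec_nonneg_of_nonneg hA (fun j => x.2.1 j) i)
        (mulVec_mono_of_nonneg hA fun j _ => hxy j) }
  refine ⟨(OrderHom.lfp f).1, fun i => (OrderHom.lfp f).2.1 i, fun i => ?_⟩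
  exact congrFun (congrArg Subtype.val (OrderHom.map_lfp f)) i

/-- Subsolutions lie below fixed points. -/
lemma le_of_le_aggr (hγ : 0 < γ) (hA : ∀ i j, 0 ≤ A i j) {x y : Fin n → ℝ} (hx0 : ∀ i, 0 ≤ x i)
    (hx : ∀ i, x i ≤ aggr γ (A.mulVec x i)) (hy0 : ∀ i, 0 ≤ y i)
    (hy : ∀ i, aggr γ (A.mulVec y i) = y i) (i : Fin n) : x i ≤ y i := by
  have hy1 : ∀ i, 0 < y i := fun i => by
    rw [← hy i]
    exact zero_lt_one.trans_le (one_le_aggr hγ (mulVec_nonneg_of_nonneg hA hy0 i))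
  obtain ⟨m, -, hm⟩ := Finset.exists_max_image Finset.univ (fun i => x i / y i)
    ⟨i, Finset.mem_univ _⟩
  have hxt : ∀ j, x j ≤ x m / y m * y j := fun j => by
    rw [← div_le_iff₀ (hy1 j)]
    exact hm j (Finset.mem_univ _)
  by_contra! hcon
  have ht : 1 < x m / y m := ((one_lt_div (hy1 i)).2 hcon).trans_le (hm i (Finset.mem_univ _))
  have h1 : A.mulVec x m ≤ x m / y m * A.mulVec y m := by
    rw [← smul_eq_mul, ← Pi.smul_apply, ← Matrix.mulVec_smul]
    exact mulVec_mono_of_nonneg hA fun j _ => hxt j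
  have h2 := (hx m).trans (aggr_mono hγ (mulVec_nonneg_of_nonneg hA hx0 m) h1)
  have h3 := aggr_mul_lt hγ ht (mulVec_nonneg_of_nonneg hA hy0 m)
  rw [hy m, div_mul_cancel₀ _ (hy1 m).ne'] at h3
  linarith

/-- Supersolutions on a closed class of states lie above fixed points. -/
lemma le_of_aggr_le (hγ : 0 < γ) (hA : ∀ i j, 0 ≤ A i j) {x y : Fin n → ℝ} {S : Set (Fin n)}
    (hS : ∀ i ∈ S, ∀ j, 0 < A i j → j ∈ S) (hx1 : ∀ i ∈ S, 0 < x i)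
    (hx : ∀ i ∈ S, aggr γ (A.mulVec x i) ≤ x i) (hy0 : ∀ i, 0 ≤ y i)
    (hy : ∀ i, aggr γ (A.mulVec y i) = y i) {i : Fin n} (hi : i ∈ S) : y i ≤ x i := by
  classical
  have hy1 : ∀ i, 0 < y i := fun i => by
    rw [← hy i]
    exact zero_lt_one.trans_le (one_le_aggr hγ (mulVec_nonneg_of_nonneg hA hy0 i))
  obtain ⟨m, hmS, hm⟩ := Finset.exists_min_image (Finset.univ.filter (· ∈ S))
    (fun i => x i / y i) ⟨i, by simpa using hi⟩
  simp only [Finset.mem_filter, Finset.mem_univ, true_and] at hmS hm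
  have hxt : ∀ j ∈ S, x m / y m * y j ≤ x j := fun j hj => by
    rw [← le_div_iff₀ (hy1 j)]
    exact hm j hj
  by_contra! hcon
  have ht : x m / y m < 1 := (hm i hi).trans_lt ((div_lt_one (hy1 i)).2 hcon)
  have ht0 : 0 < x m / y m := div_pos (hx1 m hmS) (hy1 m)
  have h1 : x m / y m * A.mulVec y m ≤ A.mulVec x m := by
    rw [← smul_eq_mul, ← Pi.smul_apply, ← Matrix.mulVec_smul]
    exact mulVec_mono_of_nonneg hA fun j hj => hxt j (hS m hmS j hj)
  have h2 := (aggr_mono hγ (mul_nonneg ht0.le (mulVec_nonneg_of_nonneg hA hy0 m)) h1).trans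
    (hx m hmS)
  have h3 := mul_aggr_lt hγ ht0 ht (mulVec_nonneg_of_nonneg hA hy0 m)
  rw [hy m, div_mul_cancel₀ _ (hy1 m).ne'] at h3
  linarith

lemma specRad_lt_one_of_aggr_le (hγ : 0 < γ) (hA : ∀ i j, 0 ≤ A i j) {x : Fin n → ℝ}
    (hx0 : ∀ i, 0 < x i) (hx : ∀ i, aggr γ (A.mulVec x i) ≤ x i) : specRad A < 1 :=
  specRad_lt_one_of_mulVec_lt hA hx0 fun i =>
    (lt_aggr hγ (mulVec_nonneg_of_nonneg hA (fun j => (hx0 j).le) i)).trans_le (hx i)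

/-- Under irreducibility, a nonempty set of states that is closed under transitions is full. -/
lemma _root_.Matrix.IsIrreducible.mem_of_closed (hA : A.IsIrreducible) {S : Set (Fin n)}
    (hS : ∀ i ∈ S, ∀ j, 0 < A i j → j ∈ S) {i : Fin n} (hi : i ∈ S) (j : Fin n) : j ∈ S := by
  let : Quiver (Fin n) := Matrix.toQuiver A
  obtain ⟨p, -⟩ := hA.connected i j
  induction p with
  | nil => exact hi
  | cons _ e ih => exact hS _ ih _ e.down

end FixedPoint

section Utility

variable {u : ℝ → EReal}

lemma IsInadaUtility.eq_coe (hu : IsInadaUtility u) {c : ℝ} (hc : 0 < c) :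
    u c = ((u c).toReal : EReal) :=
  (EReal.coe_toReal (hu.ne_top c hc) (hu.ne_bot c hc)).symm

lemma IsInadaUtility.strictAntiOn_marginal (hu : IsInadaUtility u) :
    StrictAntiOn (marginal u) (Set.Ioi 0) := by
  refine strictAntiOn_of_deriv_neg (convex_Ioi 0) (fun c hc => ?_) fun c hc => ?_
  · exact (differentiableAt_of_deriv_ne_zero
      (hu.deriv_marginal_neg c hc).ne).continuousAt.continuousWithinAt
  · rw [interior_Ioi] at hc
    exact hu.deriv_marginal_neg c hc

lemma IsInadaUtility.marginal_anti (hu : IsInadaUtility u) {x y : ℝ} (hx : 0 < x) (hxy : x ≤ y) :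
    marginal u y ≤ marginal u x :=
  hu.strictAntiOn_marginal.antitoneOn hx (hx.trans_le hxy) hxy

lemma IsInadaUtility.differentiableAt (hu : IsInadaUtility u) {c : ℝ} (hc : 0 < c) :
    DifferentiableAt ℝ (fun x => (u x).toReal) c :=
  (hu.contDiffOn.differentiableOn (by norm_num)).differentiableAt (Ioi_mem_nhds hc)

lemma measurable_marginal : Measurable (marginal u) := measurable_deriv _

/-- The mean value theorem combined with decreasing marginal utility. -/
lemma IsInadaUtility.sub_bounds (hu : IsInadaUtility u) {x y : ℝ} (hy : 0 < y) (hyx : y ≤ x) :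
    (x - y) * marginal u x ≤ (u x).toReal - (u y).toReal ∧
      (u x).toReal - (u y).toReal ≤ (x - y) * marginal u y := by
  rcases hyx.eq_or_lt with rfl | hlt
  · simp
  obtain ⟨ξ, ⟨h1, h2⟩, h3⟩ := exists_deriv_eq_slope (fun x => (u x).toReal) hlt
    (fun c hc => (hu.differentiableAt (hy.trans_le hc.1)).continuousAt.continuousWithinAt)
    (fun c hc => (hu.differentiableAt (hy.trans hc.1)).differentiableWithinAt)
  rw [eq_div_iff (sub_pos.2 hlt).ne'] at h3
  change marginal u ξ * (x - y) = _ at h3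
  rw [← h3]
  have h4 := hu.marginal_anti (hy.trans h1) h2.le
  have h5 := hu.marginal_anti hy h1.le
  constructor <;> nlinarith

lemma ofReal_add_ofReal_neg_le {r s d : ℝ} (hd : 0 ≤ d) (h : r + d ≤ s) :
    ENNReal.ofReal r + ENNReal.ofReal (-s) + ENNReal.ofReal d
      ≤ ENNReal.ofReal s + ENNReal.ofReal (-r) := by
  have key : max r 0 + max (-s) 0 + d ≤ max s 0 + max (-r) 0 := by
    rcases le_total r 0 with h1 | h1 <;> rcases le_total s 0 with h2 | h2 <;>
      simp [h1, h2] <;> linarith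
  have e : ∀ t : ℝ, ENNReal.ofReal t = ENNReal.ofReal (max t 0) := fun t => by
    rw [ENNReal.ofReal_max]; simp
  rw [e r, e (-s), e s, e (-r), ← ENNReal.ofReal_add (by positivity) (by positivity),
    ← ENNReal.ofReal_add (by positivity) hd, ← ENNReal.ofReal_add (by positivity) (by positivity)]
  exact ENNReal.ofReal_le_ofReal key

lemma ofReal_add_ofReal_neg_le' {r s d : ℝ} (hd : 0 ≤ d) (h : r ≤ s + d) :
    ENNReal.ofReal r + ENNReal.ofReal (-s)
      ≤ ENNReal.ofReal s + ENNReal.ofReal (-r) + ENNReal.ofReal d := by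
  have key : max r 0 + max (-s) 0 ≤ max s 0 + max (-r) 0 + d := by
    rcases le_total r 0 with h1 | h1 <;> rcases le_total s 0 with h2 | h2 <;>
      simp [h1, h2] <;> linarith
  have e : ∀ t : ℝ, ENNReal.ofReal t = ENNReal.ofReal (max t 0) := fun t => by
    rw [ENNReal.ofReal_max]; simp
  rw [e r, e (-s), e s, e (-r), ← ENNReal.ofReal_add (by positivity) (by positivity),
    ← ENNReal.ofReal_add (by positivity) (by positivity), ← ENNReal.ofReal_add (by positivity) hd]
  exact ENNReal.ofReal_le_ofReal key

lemma toENNReal_neg_of_eq_coe {x : EReal} {r : ℝ} (h : x = r) :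
    x.toENNReal = ENNReal.ofReal r ∧ (-x).toENNReal = ENNReal.ofReal (-r) := by
  subst h
  exact ⟨EReal.toENNReal_of_ne_top (by simp) , by
    rw [← EReal.coe_neg, EReal.toENNReal_of_ne_top (by simp)]; simp⟩

/-- Lower bound `u(x) - u(y) ≥ (x - y) u'(x)` for `0 ≤ y ≤ x`, in terms of positive and negative
parts. -/
lemma IsInadaUtility.gain_lower (hu : IsInadaUtility u) {x y : ℝ} (hy : 0 ≤ y) (hyx : y ≤ x) :
    (u y).toENNReal + (-u x).toENNReal + ENNReal.ofReal ((x - y) * marginal u x)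
      ≤ (u x).toENNReal + (-u y).toENNReal := by
  rcases hyx.eq_or_lt with rfl | hlt
  · simp
  have hx : 0 < x := hy.trans_lt hlt
  have hd : 0 ≤ (x - y) * marginal u x := mul_nonneg (by linarith) (hu.marginal_pos x hx).le
  obtain ⟨hx1, hx2⟩ := toENNReal_neg_of_eq_coe (hu.eq_coe hx)
  rw [hx1, hx2]
  rcases eq_or_ne (u y) ⊥ with hb | hb
  · simp [hb]
  have ht : u y ≠ ⊤ := by
    rcases hy.eq_or_lt with rfl | hy
    · exact fun h => hu.ne_top x hx (top_le_iff.1 (h ▸ hu.zero_le x hx))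
    · exact hu.ne_top y hy
  have hyc : u y = ((u y).toReal : EReal) := (EReal.coe_toReal ht hb).symm
  obtain ⟨hy1, hy2⟩ := toENNReal_neg_of_eq_coe hyc
  rw [hy1, hy2]
  refine ofReal_add_ofReal_neg_le hd ?_
  rcases hy.eq_or_lt with rfl | hy
  · refine le_of_forall_pos_le_add fun ε hε => ?_
    have hm := hu.marginal_pos x hx
    set w := min x (ε / marginal u x)
    have hw : 0 < w := lt_min hx (div_pos hε hm)
    have h1 := (hu.sub_bounds hw (min_le_left x _)).1
    have h2 : (u 0).toReal ≤ (u w).toReal :=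
      EReal.toReal_le_toReal (hu.zero_le w hw) hb (hu.ne_top w hw)
    have h3 : w * marginal u x ≤ ε := by
      rw [← le_div_iff₀ hm]
      exact min_le_right _ _
    linarith
  · linarith [(hu.sub_bounds hy hlt.le).1]

/-- Upper bound `u(x) - u(y) ≤ (x - y) u'(y)` for `0 < y ≤ x`, in terms of positive and negative
parts. -/
lemma IsInadaUtility.gain_upper (hu : IsInadaUtility u) {x y : ℝ} (hy : 0 < y) (hyx : y ≤ x) :
    (u x).toENNReal + (-u y).toENNReal
      ≤ (u y).toENNReal + (-u x).toENNReal + ENNReal.ofReal ((x - y) * marginal u y) := by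
  obtain ⟨hx1, hx2⟩ := toENNReal_neg_of_eq_coe (hu.eq_coe (hy.trans_le hyx))
  obtain ⟨hy1, hy2⟩ := toENNReal_neg_of_eq_coe (hu.eq_coe hy)
  rw [hx1, hx2, hy1, hy2]
  exact ofReal_add_ofReal_neg_le' (mul_nonneg (by linarith) (hu.marginal_pos y hy).le)
    (by linarith [(hu.sub_bounds hy hyx).2])

lemma IsInadaUtility.mono (hu : IsInadaUtility u) {x y : ℝ} (hy : 0 ≤ y) (hyx : y ≤ x) :
    u y ≤ u x := by
  rcases hyx.eq_or_lt with rfl | hlt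
  · rfl
  rcases hy.eq_or_lt with rfl | hy
  · exact hu.zero_le x hlt
  · rw [hu.eq_coe hy, hu.eq_coe (hy.trans hlt), EReal.coe_le_coe_iff]
    nlinarith [(hu.sub_bounds hy hyx).1, hu.marginal_pos x (hy.trans hlt)]

lemma IsInadaUtility.measurable_max (hu : IsInadaUtility u) :
    Measurable fun c : ℝ => u (max c 0) := by
  classical
  have h : (fun c : ℝ => u (max c 0)) = (Set.Ioi (0 : ℝ)).piecewise
      (fun c => ((u c).toReal : EReal)) (fun _ => u 0) := by
    funext c
    by_cases hc : c ∈ Set.Ioi 0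
    · rw [Set.piecewise_eq_of_mem _ _ _ hc, max_eq_left (le_of_lt hc)]
      exact hu.eq_coe hc
    · rw [Set.piecewise_eq_of_notMem _ _ _ hc, max_eq_right (not_lt.1 (by simpa using hc))]
  rw [h]
  refine ContinuousOn.measurable_piecewise ?_ continuousOn_const measurableSet_Ioi
  exact continuous_coe_real_ereal.comp_continuousOn hu.contDiffOn.continuousOn

lemma IsInadaUtility.exists_affine_bound (hu : IsInadaUtility u) :
    ∃ K : ℝ, 0 ≤ K ∧ ∀ c, 0 ≤ c → (u c).toENNReal ≤ ENNReal.ofReal (K * (1 + c)) := by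
  refine ⟨|(u 1).toReal| + marginal u 1,
    add_nonneg (abs_nonneg _) (hu.marginal_pos 1 one_pos).le, fun c hc => ?_⟩
  have hm := hu.marginal_pos 1 one_pos
  have h0 : (0 : ℝ) < 1 + c := by linarith
  have h1 : u c ≤ u (1 + c) := hu.mono hc (by linarith)
  refine (EReal.toENNReal_le_toENNReal h1).trans ?_
  rw [(toENNReal_neg_of_eq_coe (hu.eq_coe h0)).1]
  refine ENNReal.ofReal_le_ofReal ?_
  have h2 := (hu.sub_bounds one_pos (show (1 : ℝ) ≤ 1 + c by linarith)).2
  nlinarith [le_abs_self (u 1).toReal, abs_nonneg (u 1).toReal]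

lemma IsInadaUtility.neg_le_marginalExt (hu : IsInadaUtility u) (c : ℝ) :
    (-u c).toENNReal ≤ ENNReal.ofReal |(u 1).toReal| + marginalExt u c := by
  unfold marginalExt
  split_ifs with hc
  · have hm := hu.marginal_pos c hc
    rw [(toENNReal_neg_of_eq_coe (hu.eq_coe hc)).2, ← ENNReal.ofReal_add (abs_nonneg _) hm.le]
    refine ENNReal.ofReal_le_ofReal ?_
    rcases le_total c 1 with h1 | h1
    · nlinarith [(hu.sub_bounds hc h1).2, neg_abs_le (u 1).toReal]
    · nlinarith [(hu.sub_bounds one_pos h1).1, neg_abs_le (u 1).toReal]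
  · simp

lemma measurable_marginalExt : Measurable (marginalExt u) :=
  Measurable.ite measurableSet_Ioi (measurable_marginal.ennreal_ofReal) measurable_const

end Utility

variable {n : ℕ} {E₁ E₂ E₃ : Type*}
  [MeasurableSpace E₁] [MeasurableSpace E₂] [MeasurableSpace E₃]

namespace Model

variable (M : Model n E₁ E₂ E₃)

section Law

instance (z : Fin n) : IsProbabilityMeasure (M.law z) := by
  unfold law; infer_instance

lemma P_nonneg (i j : Fin n) : 0 ≤ M.P i j := M.P_mem.1 i j

lemma P_le_one (i j : Fin n) : M.P i j ≤ 1 := by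
  have h1 : ∑ j, M.P i j = 1 := by
    have h := congrFun M.P_mem.2 i
    simpa [Matrix.mulVec, dotProduct] using h
  rw [← h1]
  exact Finset.single_le_sum (f := fun j => M.P i j) (fun j _ => M.P_nonneg i j)
    (Finset.mem_univ j)

lemma measurable_shock_iff {α : Type*} [MeasurableSpace α] {g : Shock n E₁ E₂ E₃ → α}
    (h : ∀ z, Measurable fun e => g (z, e)) : Measurable g :=
  measurable_from_prod_countable_right h

lemma measurable_coord {i t : ℕ} (hit : i ≤ t) :
    Measurable[Filtration.piLE (X := fun _ : ℕ => Shock n E₁ E₂ E₃) t]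
      fun ω : Path n E₁ E₂ E₃ => ω i := by
  rw [Filtration.piLE_eq_comap_frestrictLe]
  have h : (fun ω : Path n E₁ E₂ E₃ => ω i)
      = (fun h : (j : Finset.Iic t) → Shock n E₁ E₂ E₃ => h ⟨i, Finset.mem_Iic.2 hit⟩)
        ∘ Preorder.frestrictLe (π := fun _ : ℕ => Shock n E₁ E₂ E₃) t := rfl
  rw [h]
  exact (measurable_pi_apply _).comp (comap_measurable _)

lemma lintegral_step {g : Shock n E₁ E₂ E₃ → ℝ≥0∞} (hg : Measurable g) (s : Shock n E₁ E₂ E₃) :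
    ∫⁻ s', g s' ∂(M.step s)
      = ∑ z', ENNReal.ofReal (M.P s.1 z') * ∫⁻ e, g (z', e) ∂M.lawInnov := by
  change ∫⁻ s', g s' ∂((M.row s.1).prod M.lawInnov) = _
  rw [lintegral_prod _ hg.aemeasurable, row, lintegral_finsetSum_measure]
  refine Finset.sum_congr rfl fun z' _ => ?_
  rw [lintegral_smul_measure, lintegral_dirac, smul_eq_mul]

/-- The Markov property of the exogenous process. -/
lemma lintegral_law_succ (z : Fin n) (t : ℕ) {F : Path n E₁ E₂ E₃ → ℝ≥0∞}
    (hF : Measurable[Filtration.piLE (X := fun _ : ℕ => Shock n E₁ E₂ E₃) t] F)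
    {g : Shock n E₁ E₂ E₃ → ℝ≥0∞} (hg : Measurable g) :
    ∫⁻ ω, F ω * g (ω (t + 1)) ∂(M.law z)
      = ∫⁻ ω, F ω * ∑ z', ENNReal.ofReal (M.P (ω t).1 z') * ∫⁻ e, g (z', e) ∂M.lawInnov
        ∂(M.law z) := by
  rw [Filtration.piLE_eq_comap_frestrictLe] at hF
  obtain ⟨F', hF', rfl⟩ := hF.exists_eq_measurable_comp
  have hmap := Kernel.map_frestrictLe_trajMeasure_compProd_eq_map_trajMeasure
    (X := fun _ : ℕ => Shock n E₁ E₂ E₃) (κ := M.histKernel)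
    (μ₀ := (Measure.dirac z).prod M.lawInnov) (a := t)
  have hfr : Measurable (Preorder.frestrictLe (π := fun _ : ℕ => Shock n E₁ E₂ E₃) t) := by
    fun_prop
  have hm : Measurable fun p : ((i : Finset.Iic t) → Shock n E₁ E₂ E₃) × Shock n E₁ E₂ E₃ =>
      F' p.1 * g p.2 := (hF'.comp measurable_fst).mul (hg.comp measurable_snd)
  have h1 : ∫⁻ ω, F' (Preorder.frestrictLe t ω) * g (ω (t + 1)) ∂(M.law z)
      = ∫⁻ p, F' p.1 * g p.2 ∂((M.law z).map
        (fun x => (Preorder.frestrictLe (π := fun _ : ℕ => Shock n E₁ E₂ E₃) t x, x (t + 1)))) := by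
    rw [lintegral_map hm (hfr.prodMk (measurable_pi_apply _))]
  change ∫⁻ ω, F' (Preorder.frestrictLe t ω) * g (ω (t + 1)) ∂(M.law z) = _
  rw [h1]
  unfold law
  rw [← hmap, Measure.lintegral_compProd hm]
  have h2 : ∀ h : (i : Finset.Iic t) → Shock n E₁ E₂ E₃,
      ∫⁻ s, F' h * g s ∂(M.histKernel t h) = F' h * ∑ z', ENNReal.ofReal
        (M.P (h ⟨t, Finset.mem_Iic.2 le_rfl⟩).1 z') * ∫⁻ e, g (z', e) ∂M.lawInnov := fun h => by
    rw [lintegral_const_mul _ hg]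
    congr 1
    exact M.lintegral_step hg _
  simp_rw [h2]
  rw [lintegral_map _ hfr]
  · rfl
  · refine hF'.mul (Finset.measurable_sum _ fun z' _ => Measurable.mul_const ?_ _)
    exact (measurable_of_finite (fun y : Fin n => ENNReal.ofReal (M.P y z'))).comp
      (measurable_fst.comp (measurable_pi_apply _))

lemma ae_state_zero (z : Fin n) : ∀ᵐ ω ∂(M.law z), (ω 0).1 = z := by
  have hfr : Measurable (Preorder.frestrictLe (π := fun _ : ℕ => Shock n E₁ E₂ E₃) 0) := by
    fun_prop
  have hset : MeasurableSet {s : Shock n E₁ E₂ E₃ | s.1 = z} :=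
    measurable_fst (measurableSet_singleton z)
  have hmap : (M.law z).map (Preorder.frestrictLe 0)
      = ((Measure.dirac z).prod M.lawInnov).map
        (MeasurableEquiv.piUnique (fun i : Finset.Iic 0 => Shock n E₁ E₂ E₃)).symm := by
    rw [law, Kernel.trajMeasure, Measure.map_comp _ _ hfr, Kernel.traj_map_frestrictLe,
      Kernel.partialTraj_self, Measure.id_comp]
  have h0 : (M.law z).map (fun ω => ω 0) = (Measure.dirac z).prod M.lawInnov := by
    have h1 : (fun ω : Path n E₁ E₂ E₃ => ω 0)
        = (MeasurableEquiv.piUnique (fun i : Finset.Iic 0 => Shock n E₁ E₂ E₃))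
          ∘ Preorder.frestrictLe (π := fun _ : ℕ => Shock n E₁ E₂ E₃) 0 := rfl
    rw [h1, ← Measure.map_map (MeasurableEquiv.measurable _) hfr, hmap,
      Measure.map_map (MeasurableEquiv.measurable _) (MeasurableEquiv.measurable _),
      MeasurableEquiv.self_comp_symm, Measure.map_id]
  have h2 : ∀ᵐ s ∂((Measure.dirac z).prod M.lawInnov), s.1 = z := by
    rw [Measure.ae_prod_iff_ae_ae hset, ae_dirac_iff]
    · simp
    · simp
  rw [← h0] at h2
  exact ae_of_ae_map (measurable_pi_apply 0).aemeasurable h2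

/-- The law of the first-period shocks. -/
lemma lintegral_law_one (z : Fin n) {g : Shock n E₁ E₂ E₃ → ℝ≥0∞} (hg : Measurable g) :
    ∫⁻ ω, g (ω 1) ∂(M.law z)
      = ∑ z', ENNReal.ofReal (M.P z z') * ∫⁻ e, g (z', e) ∂M.lawInnov := by
  have h := M.lintegral_law_succ z 0 (F := fun _ => 1) measurable_const hg
  simp only [one_mul, zero_add] at h
  rw [h]
  have h2 : ∀ᵐ ω ∂(M.law z),
      (∑ z', ENNReal.ofReal (M.P (ω 0).1 z') * ∫⁻ e, g (z', e) ∂M.lawInnov)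
        = ∑ z', ENNReal.ofReal (M.P z z') * ∫⁻ e, g (z', e) ∂M.lawInnov := by
    filter_upwards [M.ae_state_zero z] with ω hω
    rw [hω]
  rw [lintegral_congr_ae h2]
  simp

end Law

section Means

lemma condMean_nonneg {X : Fin n → E₁ × E₂ × E₃ → ℝ} (hX : ∀ z e, 0 ≤ X z e) (z : Fin n) :
    0 ≤ M.condMean X z := integral_nonneg (hX z)

lemma mul_diag_nonneg {X : Fin n → E₁ × E₂ × E₃ → ℝ} (hX : ∀ z e, 0 ≤ X z e) (i j : Fin n) :
    0 ≤ (M.P * M.diag X) i j := by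
  rw [diag, Matrix.mul_diagonal]
  exact mul_nonneg (M.P_nonneg i j) (M.condMean_nonneg hX j)

lemma sum_lintegral_ofReal_mul {X : Fin n → E₁ × E₂ × E₃ → ℝ} (hX : ∀ z e, 0 ≤ X z e)
    (hint : ∀ z, M.FiniteMean X z) {p : Fin n → ℝ} (hp : ∀ z, 0 ≤ p z) (z : Fin n) :
    ∑ z', ENNReal.ofReal (M.P z z') * ∫⁻ e, ENNReal.ofReal (X z' e * p z') ∂M.lawInnov
      = ENNReal.ofReal ((M.P * M.diag X).mulVec p z) := by
  rw [Matrix.mulVec, dotProduct, ENNReal.ofReal_sum_of_nonneg]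
  · refine Finset.sum_congr rfl fun z' _ => ?_
    rw [diag, Matrix.mul_diagonal, mul_assoc, ENNReal.ofReal_mul (M.P_nonneg z z')]
    congr 1
    rw [condMean, ← integral_mul_const, ofReal_integral_eq_lintegral_ofReal]
    · exact (hint z').mul_const _
    · exact ae_of_all _ fun e => mul_nonneg (hX z' e) (hp z')
  · exact fun z' _ => mul_nonneg (M.mul_diag_nonneg hX z z') (hp z')

end Means

end Model

/-- A nonnegative sequence driven by a contraction and a summable input is summable. -/
lemma tsum_ne_top_of_le_mul_add {f g : ℕ → ℝ≥0∞} {r : ℝ≥0∞} (hr : r < 1) (h0 : f 0 ≠ ⊤)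
    (hg : ∑' t, g t ≠ ⊤) (h : ∀ t, f (t + 1) ≤ r * f t + g t) : ∑' t, f t ≠ ⊤ := by
  have hr1 : 1 - r ≠ 0 := (tsub_pos_of_lt hr).ne'
  have hr2 : 1 - r ≠ ⊤ := ENNReal.sub_ne_top ENNReal.one_ne_top
  set c := f 0 + ∑' t, g t with hc
  have hid : c + r * (c * (1 - r)⁻¹) = c * (1 - r)⁻¹ := by
    calc c + r * (c * (1 - r)⁻¹) = c * ((1 - r) * (1 - r)⁻¹) + r * (c * (1 - r)⁻¹) := by
          rw [ENNReal.mul_inv_cancel hr1 hr2, mul_one]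
      _ = (1 - r + r) * (c * (1 - r)⁻¹) := by ring
      _ = c * (1 - r)⁻¹ := by rw [tsub_add_cancel_of_le hr.le, one_mul]
  have hS : ∀ N, ∑ t ∈ Finset.range N, f t ≤ c * (1 - r)⁻¹ := fun N => by
    induction N with
    | zero => simp
    | succ N ih =>
      rw [Finset.sum_range_succ']
      calc ∑ t ∈ Finset.range N, f (t + 1) + f 0
          ≤ ∑ t ∈ Finset.range N, (r * f t + g t) + f 0 := by gcongr with t; exact h t
        _ = r * ∑ t ∈ Finset.range N, f t + (f 0 + ∑ t ∈ Finset.range N, g t) := by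
          rw [Finset.sum_add_distrib, Finset.mul_sum]; ring
        _ ≤ r * (c * (1 - r)⁻¹) + c := by
          gcongr
          rw [hc]
          gcongr
          exact ENNReal.sum_le_tsum _
        _ = c * (1 - r)⁻¹ := by rw [add_comm, hid]
  refine ne_top_of_le_ne_top (ENNReal.mul_ne_top (ENNReal.add_ne_top.2 ⟨h0, hg⟩)
    (ENNReal.inv_ne_top.2 hr1)) ?_
  rw [ENNReal.tsum_eq_iSup_nat]
  exact iSup_le hS

namespace Model

variable (M : Model n E₁ E₂ E₃)

lemma measurable_β_shock : Measurable fun s : Shock n E₁ E₂ E₃ => M.β s.1 s.2.1 :=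
  measurable_shock_iff fun z => (M.measurable_β z).comp measurable_fst

lemma measurable_R_shock : Measurable fun s : Shock n E₁ E₂ E₃ => M.R s.1 s.2.2.1 :=
  measurable_shock_iff fun z => (M.measurable_R z).comp (measurable_fst.comp measurable_snd)

lemma measurable_Y_shock : Measurable fun s : Shock n E₁ E₂ E₃ => M.Y s.1 s.2.2.2 :=
  measurable_shock_iff fun z => (M.measurable_Y z).comp (measurable_snd.comp measurable_snd)

lemma measurable_varβ (z : Fin n) : Measurable (M.varβ z) :=
  (M.measurable_β z).comp measurable_fst

lemma measurable_varβR (z : Fin n) : Measurable (M.varβR z) :=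
  ((M.measurable_β z).comp measurable_fst).mul
    ((M.measurable_R z).comp (measurable_fst.comp measurable_snd))

lemma measurable_βY (z : Fin n) :
    Measurable fun e : E₁ × E₂ × E₃ => M.β z e.1 * M.Y z e.2.2 :=
  ((M.measurable_β z).comp measurable_fst).mul
    ((M.measurable_Y z).comp (measurable_snd.comp measurable_snd))

section Plans

/-- The information available at date `t`. -/
abbrev info (t : ℕ) : MeasurableSpace (Path n E₁ E₂ E₃) :=
  Filtration.piLE (X := fun _ : ℕ => Shock n E₁ E₂ E₃) t

lemma info_le (t : ℕ) : info t ≤ (MeasurableSpace.pi : MeasurableSpace (Path n E₁ E₂ E₃)) :=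
  (Filtration.piLE (X := fun _ : ℕ => Shock n E₁ E₂ E₃)).le t

lemma info_mono {s t : ℕ} (h : s ≤ t) :
    (info s : MeasurableSpace (Path n E₁ E₂ E₃)) ≤ info t :=
  (Filtration.piLE (X := fun _ : ℕ => Shock n E₁ E₂ E₃)).mono h

lemma measurable_βAt {i t : ℕ} (h : i ≤ t) : Measurable[info t] (M.βAt i) :=
  M.measurable_β_shock.comp (measurable_coord h)

lemma measurable_RAt {i t : ℕ} (h : i ≤ t) : Measurable[info t] (M.RAt i) :=
  M.measurable_R_shock.comp (measurable_coord h)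

lemma measurable_YAt {i t : ℕ} (h : i ≤ t) : Measurable[info t] (M.YAt i) :=
  M.measurable_Y_shock.comp (measurable_coord h)

lemma measurable_discount (t : ℕ) : Measurable[info t] (M.discount t) := by
  unfold discount
  exact Finset.measurable_fun_prod _ fun i hi => M.measurable_βAt (Finset.mem_range.1 hi)

lemma discount_nonneg (t : ℕ) (ω : Path n E₁ E₂ E₃) : 0 ≤ M.discount t ω :=
  Finset.prod_nonneg fun _ _ => M.β_nonneg _ _

lemma discount_succ (t : ℕ) (ω : Path n E₁ E₂ E₃) :
    M.discount (t + 1) ω = M.discount t ω * M.βAt (t + 1) ω :=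
  Finset.prod_range_succ _ _

lemma measurable_wealth {a : ℝ} {C : ℕ → Path n E₁ E₂ E₃ → ℝ}
    (hC : ∀ t, Measurable[info t] (C t)) (t : ℕ) : Measurable[info t] (M.wealth a C t) := by
  induction t with
  | zero => exact measurable_const
  | succ t ih =>
    exact ((M.measurable_RAt le_rfl).mul ((ih.mono (info_mono t.le_succ) le_rfl).sub
      ((hC t).mono (info_mono t.le_succ) le_rfl))).add (M.measurable_YAt le_rfl)

/-- Wealth when nothing is consumed. -/
abbrev grossWealth (a : ℝ) : ℕ → Path n E₁ E₂ E₃ → ℝ := M.wealth a fun _ _ => 0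

lemma grossWealth_nonneg {a : ℝ} (ha : 0 ≤ a) (t : ℕ) (ω : Path n E₁ E₂ E₃) :
    0 ≤ M.grossWealth a t ω := by
  induction t with
  | zero => exact ha
  | succ t ih =>
    exact add_nonneg (mul_nonneg (M.R_nonneg _ _) (by simpa using ih)) (M.Y_nonneg _ _)

lemma IsFeasible.wealth_le {M : Model n E₁ E₂ E₃} {a : ℝ} {C : ℕ → Path n E₁ E₂ E₃ → ℝ}
    (hC : M.IsFeasible a C) (t : ℕ) (ω : Path n E₁ E₂ E₃) :
    M.wealth a C t ω ≤ M.grossWealth a t ω := by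
  induction t with
  | zero => exact le_rfl
  | succ t ih =>
    refine add_le_add_left (mul_le_mul_of_nonneg_left ?_ (M.R_nonneg _ _)) _
    have := hC.nonneg t ω
    linarith

lemma IsFeasible.measurable {M : Model n E₁ E₂ E₃} {a : ℝ} {C : ℕ → Path n E₁ E₂ E₃ → ℝ}
    (hC : M.IsFeasible a C) (t : ℕ) : Measurable (C t) := (hC.adapted t).mono (info_le t) le_rfl

end Plans

section Moments

variable {M}

lemma lintegral_mul_succ (z : Fin n) (t : ℕ) {F : Path n E₁ E₂ E₃ → ℝ≥0∞}
    (hF : Measurable[info t] F) {X : Fin n → E₁ × E₂ × E₃ → ℝ}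
    (hXm : ∀ z, Measurable (X z)) (hX : ∀ z e, 0 ≤ X z e)
    (hint : ∀ z, M.FiniteMean X z) {p : Fin n → ℝ} (hp : ∀ z, 0 ≤ p z) :
    ∫⁻ ω, F ω * ENNReal.ofReal (X (ω (t + 1)).1 (ω (t + 1)).2 * p (ω (t + 1)).1) ∂(M.law z)
      = ∫⁻ ω, F ω * ENNReal.ofReal ((M.P * M.diag X).mulVec p (ω t).1) ∂(M.law z) := by
  have hg : Measurable fun s : Shock n E₁ E₂ E₃ => ENNReal.ofReal (X s.1 s.2 * p s.1) :=
    measurable_shock_iff fun z => ((hXm z).mul_const (p z)).ennreal_ofReal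
  rw [M.lintegral_law_succ z t hF hg]
  refine lintegral_congr fun ω => ?_
  rw [M.sum_lintegral_ofReal_mul hX hint hp]

lemma tsum_lintegral_discount_ne_top (hβ : ∀ z, M.FiniteMean M.varβ z)
    (hr : specRad (M.P * M.diag M.varβ) < 1) (z : Fin n) :
    ∑' t, ∫⁻ ω, ENNReal.ofReal (M.discount t ω) ∂(M.law z) ≠ ⊤ := by
  have hβ0 : ∀ z e, 0 ≤ M.varβ z e := fun z e => M.β_nonneg z e.1
  obtain ⟨ρ, p, hρ0, hρ1, hp, hAp⟩ :=
    exists_mulVec_le_of_specRad_lt_one (M.mul_diag_nonneg hβ0) hr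
  have hp0 : ∀ z, 0 ≤ p z := fun z => zero_le_one.trans (hp z)
  have key : ∑' t, ∫⁻ ω, ENNReal.ofReal (M.discount t ω) * ENNReal.ofReal (p (ω t).1) ∂(M.law z)
      ≠ ⊤ := by
    refine tsum_ne_top_of_le_mul_add (g := fun _ => 0) (r := ENNReal.ofReal ρ)
      (by rwa [ENNReal.ofReal_lt_one]) ?_ (by simp) fun t => ?_
    · have h : ∀ᵐ ω ∂(M.law z), ENNReal.ofReal (M.discount 0 ω) * ENNReal.ofReal (p (ω 0).1)
          = ENNReal.ofReal (p z) := by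
        filter_upwards [M.ae_state_zero z] with ω hω
        simp [discount, hω]
      rw [lintegral_congr_ae h]
      simp
    · have h : ∀ ω, ENNReal.ofReal (M.discount (t + 1) ω) * ENNReal.ofReal (p (ω (t + 1)).1)
          = ENNReal.ofReal (M.discount t ω) *
            ENNReal.ofReal (M.varβ (ω (t + 1)).1 (ω (t + 1)).2 * p (ω (t + 1)).1) := fun ω => by
        rw [discount_succ, ENNReal.ofReal_mul (M.discount_nonneg _ _), mul_assoc,
          ← ENNReal.ofReal_mul (show 0 ≤ M.βAt (t + 1) ω from M.β_nonneg _ _)]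
        rfl
      simp_rw [h]
      rw [lintegral_mul_succ z t (M.measurable_discount t).ennreal_ofReal
        M.measurable_varβ hβ0 hβ hp0, add_zero,
        ← lintegral_const_mul']
      · refine lintegral_mono fun ω => ?_
        rw [mul_left_comm, ← ENNReal.ofReal_mul hρ0.le]
        gcongr
        exact hAp _
      · exact ENNReal.ofReal_ne_top
  refine ne_top_of_le_ne_top key (ENNReal.tsum_le_tsum fun t => lintegral_mono fun ω => ?_)
  exact le_mul_of_one_le_right zero_le (ENNReal.one_le_ofReal.2 (hp _))

lemma integrable_mul_Y (hβ : ∀ z, M.FiniteMean M.varβ z) (hY : ∀ z, M.FiniteMean M.varY z)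
    (z : Fin n) : M.FiniteMean (fun z e => M.β z e.1 * M.Y z e.2.2) z := by
  have h1 : Integrable (M.β z) M.lawε := by
    have := hβ z
    unfold FiniteMean varβ lawInnov at this
    rw [← Measure.fst_prod (μ := M.lawε) (ν := M.lawζ.prod M.lawη), Measure.fst,
      integrable_map_measure (M.measurable_β z).aestronglyMeasurable measurable_fst.aemeasurable]
    exact this
  have h2 : Integrable (fun e : E₂ × E₃ => M.Y z e.2) (M.lawζ.prod M.lawη) := by
    have := hY z
    unfold FiniteMean varY lawInnov at this
    rw [← Measure.snd_prod (μ := M.lawε) (ν := M.lawζ.prod M.lawη), Measure.snd,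
      integrable_map_measure (f := Prod.snd) (g := fun e : E₂ × E₃ => M.Y z e.2)
        ((M.measurable_Y z).comp measurable_snd).aestronglyMeasurable measurable_snd.aemeasurable]
    exact this
  exact h1.mul_prod h2

lemma tsum_lintegral_grossWealth_ne_top {u : ℝ → EReal} (hM : SpectralConditions M u)
    {a : ℝ} (ha : 0 ≤ a) (z : Fin n) :
    ∑' t, ∫⁻ ω, ENNReal.ofReal (M.discount t ω * M.grossWealth a t ω) ∂(M.law z) ≠ ⊤ := by
  have hβR0 : ∀ z e, 0 ≤ M.varβR z e := fun z e => mul_nonneg (M.β_nonneg z _) (M.R_nonneg z _)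
  have hβY0 : ∀ z (e : E₁ × E₂ × E₃), 0 ≤ M.β z e.1 * M.Y z e.2.2 :=
    fun z e => mul_nonneg (M.β_nonneg z _) (M.Y_nonneg z _)
  obtain ⟨ρ, q, hρ0, hρ1, hq, hAq⟩ :=
    exists_mulVec_le_of_specRad_lt_one (M.mul_diag_nonneg hβR0) hM.specRad_βR
  have hq0 : ∀ z, 0 ≤ q z := fun z => zero_le_one.trans (hq z)
  set B : Matrix (Fin n) (Fin n) ℝ := M.P * M.diag fun z e => M.β z e.1 * M.Y z e.2.2
  have hB : ∀ z', 0 ≤ B.mulVec q z' :=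
    mulVec_nonneg_of_nonneg (M.mul_diag_nonneg hβY0) hq0
  set K : ℝ≥0∞ := ENNReal.ofReal (∑ z', B.mulVec q z')
  have hdw : ∀ t, Measurable[info t] fun ω =>
      ENNReal.ofReal (M.discount t ω * M.grossWealth a t ω) := fun t =>
    ((M.measurable_discount t).mul (M.measurable_wealth (fun _ => measurable_const) t)).ennreal_ofReal
  have key : ∑' t, ∫⁻ ω, ENNReal.ofReal (M.discount t ω * M.grossWealth a t ω) *
      ENNReal.ofReal (q (ω t).1) ∂(M.law z) ≠ ⊤ := by
    refine tsum_ne_top_of_le_mul_add (r := ENNReal.ofReal ρ)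
      (g := fun t => K * ∫⁻ ω, ENNReal.ofReal (M.discount t ω) ∂(M.law z))
      (by rwa [ENNReal.ofReal_lt_one]) ?_ ?_ fun t => ?_
    · have h : ∀ᵐ ω ∂(M.law z), ENNReal.ofReal (M.discount 0 ω * M.grossWealth a 0 ω) *
          ENNReal.ofReal (q (ω 0).1) = ENNReal.ofReal a * ENNReal.ofReal (q z) := by
        filter_upwards [M.ae_state_zero z] with ω hω
        simp [discount, hω, wealth]
      rw [lintegral_congr_ae h]
      simp [ENNReal.mul_eq_top]
    · rw [ENNReal.tsum_mul_left]
      exact ENNReal.mul_ne_top ENNReal.ofReal_ne_top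
        (tsum_lintegral_discount_ne_top hM.finite_β hM.specRad_β z)
    · have h : ∀ ω, ENNReal.ofReal (M.discount (t + 1) ω * M.grossWealth a (t + 1) ω) *
          ENNReal.ofReal (q (ω (t + 1)).1)
          = ENNReal.ofReal (M.discount t ω * M.grossWealth a t ω) *
            ENNReal.ofReal (M.varβR (ω (t + 1)).1 (ω (t + 1)).2 * q (ω (t + 1)).1)
            + ENNReal.ofReal (M.discount t ω) *
            ENNReal.ofReal (M.β (ω (t + 1)).1 (ω (t + 1)).2.1 * M.Y (ω (t + 1)).1 (ω (t + 1)).2.2.2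
              * q (ω (t + 1)).1) := fun ω => by
        have hd := M.discount_nonneg t ω
        have hw := M.grossWealth_nonneg ha t ω
        have hw1 := M.grossWealth_nonneg ha (t + 1) ω
        rw [← ENNReal.ofReal_mul (mul_nonneg (M.discount_nonneg _ _) hw1),
          ← ENNReal.ofReal_mul (mul_nonneg hd hw), ← ENNReal.ofReal_mul hd,
          ← ENNReal.ofReal_add
            (mul_nonneg (mul_nonneg hd hw) (mul_nonneg (hβR0 _ _) (hq0 _)))
            (mul_nonneg hd (mul_nonneg (hβY0 _ _) (hq0 _)))]
        congr 1
        rw [discount_succ]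
        simp only [wealth, varβR, βAt, RAt, YAt, sub_zero]
        ring
      simp_rw [h]
      rw [lintegral_add_left]
      · refine add_le_add ?_ ?_
        · rw [lintegral_mul_succ z t (hdw t) M.measurable_varβR hβR0
            hM.finite_βR hq0, ← lintegral_const_mul' _ _ ENNReal.ofReal_ne_top]
          refine lintegral_mono fun ω => ?_
          rw [mul_left_comm, ← ENNReal.ofReal_mul hρ0.le]
          gcongr
          exact hAq _
        · rw [lintegral_mul_succ (X := fun z e => M.β z e.1 * M.Y z e.2.2) z t
            (M.measurable_discount t).ennreal_ofReal M.measurable_βY hβY0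
            (integrable_mul_Y hM.finite_β hM.finite_Y) hq0,
            ← lintegral_const_mul' _ _ ENNReal.ofReal_ne_top]
          refine lintegral_mono fun ω => ?_
          rw [mul_comm]
          gcongr
          exact Finset.single_le_sum (f := fun z' => B.mulVec q z') (fun z' _ => hB z')
            (Finset.mem_univ _)
      · refine ((hdw t).mono (info_le t) le_rfl).mul ?_
        have hg : Measurable fun s : Shock n E₁ E₂ E₃ =>
            ENNReal.ofReal (M.varβR s.1 s.2 * q s.1) :=
          measurable_shock_iff fun z => ((M.measurable_varβR z).mul_const (q z)).ennreal_ofReal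
        exact hg.comp ((measurable_coord le_rfl).mono (info_le (t + 1)) le_rfl)
  refine ne_top_of_le_ne_top key (ENNReal.tsum_le_tsum fun t => lintegral_mono fun ω => ?_)
  exact le_mul_of_one_le_right zero_le (ENNReal.one_le_ofReal.2 (hq _))

end Moments

end Model

lemma add_le_add_of_coe_sub_le {p m p' m' : ℝ≥0∞} (hp : p ≠ ⊤) (hm : m ≠ ⊤) (hp' : p' ≠ ⊤)
    (hm' : m' ≠ ⊤) (h : (p' : EReal) - (m' : EReal) ≤ (p : EReal) - (m : EReal)) :
    p' + m ≤ p + m' := by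
  lift p to NNReal using hp
  lift m to NNReal using hm
  lift p' to NNReal using hp'
  lift m' to NNReal using hm'
  simp only [EReal.coe_nnreal_eq_coe_real, ← EReal.coe_sub,
    EReal.coe_le_coe_iff] at h
  have : (p' : ℝ) + m ≤ p + m' := by linarith
  exact_mod_cast this

namespace Model

variable {M : Model n E₁ E₂ E₃} {u : ℝ → EReal}

section Values

variable (M) in
/-- Expected discounted sum of a function `f` of consumption. -/
def discountedSum (f : ℝ → ℝ≥0∞) (z : Fin n) (C : ℕ → Path n E₁ E₂ E₃ → ℝ) : ℝ≥0∞ :=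
  ∫⁻ ω, ∑' t, ENNReal.ofReal (M.discount t ω) * f (C t ω) ∂(M.law z)

lemma measurable_discount_mul {f : ℝ → ℝ≥0∞} (hf : Measurable fun x => f (max x 0))
    {C : ℕ → Path n E₁ E₂ E₃ → ℝ} (hC : ∀ t, Measurable (C t)) (hC0 : ∀ t ω, 0 ≤ C t ω) (t : ℕ) :
    Measurable fun ω => ENNReal.ofReal (M.discount t ω) * f (C t ω) := by
  refine (((M.measurable_discount t).mono (info_le t) le_rfl).ennreal_ofReal).mul ?_
  have h : (fun ω => f (C t ω)) = (fun x => f (max x 0)) ∘ C t := by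
    funext ω
    simp [max_eq_left (hC0 t ω)]
  rw [h]
  exact hf.comp (hC t)

lemma discountedSum_eq_tsum {f : ℝ → ℝ≥0∞} (hf : Measurable fun x => f (max x 0))
    {C : ℕ → Path n E₁ E₂ E₃ → ℝ} (hC : ∀ t, Measurable (C t)) (hC0 : ∀ t ω, 0 ≤ C t ω)
    (z : Fin n) : M.discountedSum f z C
      = ∑' t, ∫⁻ ω, ENNReal.ofReal (M.discount t ω) * f (C t ω) ∂(M.law z) :=
  lintegral_tsum fun t => (measurable_discount_mul hf hC hC0 t).aemeasurable

lemma _root_.IncomeFluctuation.IsInadaUtility.measurable_pos (hu : IsInadaUtility u) :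
    Measurable fun c : ℝ => (u (max c 0)).toENNReal :=
  measurable_ereal_toENNReal.comp hu.measurable_max

lemma _root_.IncomeFluctuation.IsInadaUtility.measurable_neg (hu : IsInadaUtility u) :
    Measurable fun c : ℝ => (-u (max c 0)).toENNReal :=
  measurable_ereal_toENNReal.comp (continuous_neg.measurable.comp hu.measurable_max)

/-- The expected discounted positive parts of utility are finite for every feasible plan. -/
lemma discountedSum_pos_ne_top (hu : IsInadaUtility u) (hM : SpectralConditions M u) {a : ℝ}
    (ha : 0 ≤ a) (z : Fin n) {C : ℕ → Path n E₁ E₂ E₃ → ℝ} (hC : M.IsFeasible a C) :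
    M.discountedSum (fun c => (u c).toENNReal) z C ≠ ⊤ := by
  rw [discountedSum_eq_tsum hu.measurable_pos hC.measurable hC.nonneg]
  obtain ⟨K, hK, hbound⟩ := hu.exists_affine_bound
  have h1 := tsum_lintegral_discount_ne_top hM.finite_β hM.specRad_β z
  have h2 := tsum_lintegral_grossWealth_ne_top hM ha z
  refine ne_top_of_le_ne_top (ENNReal.mul_ne_top (ENNReal.ofReal_ne_top (r := K))
    (ENNReal.add_ne_top.2 ⟨h1, h2⟩)) ?_
  rw [← ENNReal.tsum_add, ← ENNReal.tsum_mul_left]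
  refine ENNReal.tsum_le_tsum fun t => ?_
  rw [← lintegral_add_left ((M.measurable_discount t).mono (info_le t) le_rfl).ennreal_ofReal,
    ← lintegral_const_mul' _ _ ENNReal.ofReal_ne_top]
  refine lintegral_mono fun ω => ?_
  have hd := M.discount_nonneg t ω
  have hw := M.grossWealth_nonneg ha t ω
  have hc : C t ω ≤ M.grossWealth a t ω := (hC.le_wealth t ω).trans (hC.wealth_le t ω)
  rw [← ENNReal.ofReal_add hd (mul_nonneg hd hw), ← ENNReal.ofReal_mul hK]
  refine (mul_le_mul_right (hbound _ (hC.nonneg t ω)) _).trans ?_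
  rw [← ENNReal.ofReal_mul hd]
  refine ENNReal.ofReal_le_ofReal ?_
  calc M.discount t ω * (K * (1 + C t ω))
      ≤ M.discount t ω * (K * (1 + M.grossWealth a t ω)) := by gcongr
    _ = K * (M.discount t ω + M.discount t ω * M.grossWealth a t ω) := by ring

variable (M) in
/-- Consume initial wealth at once, and income afterwards. -/
def incomePlan (a : ℝ) : ℕ → Path n E₁ E₂ E₃ → ℝ
  | 0, _ => a
  | t + 1, ω => M.YAt (t + 1) ω

lemma wealth_incomePlan (a : ℝ) (t : ℕ) (ω : Path n E₁ E₂ E₃) :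
    M.wealth a (M.incomePlan a) t ω = M.incomePlan a t ω := by
  induction t with
  | zero => rfl
  | succ t ih => simp [wealth, ih, incomePlan]

lemma isFeasible_incomePlan {a : ℝ} (ha : 0 ≤ a) : M.IsFeasible a (M.incomePlan a) where
  adapted
    | 0 => measurable_const
    | _ + 1 => M.measurable_YAt le_rfl
  nonneg
    | 0, _ => ha
    | _ + 1, _ => M.Y_nonneg _ _
  le_wealth t ω := (wealth_incomePlan a t ω).ge

lemma lintegral_β_mul_neg_Y_ne_top (hu : IsInadaUtility u) (hM : SpectralConditions M u)
    (z : Fin n) :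
    ∫⁻ e, ENNReal.ofReal (M.β z e.1) * (-u (M.Y z e.2.2)).toENNReal ∂M.lawInnov ≠ ⊤ := by
  have hm : Measurable fun e : E₂ × E₃ => (-u (M.Y z e.2)).toENNReal := by
    have h : (fun e : E₂ × E₃ => (-u (M.Y z e.2)).toENNReal)
        = (fun x => (-u (max x 0)).toENNReal) ∘ fun e : E₂ × E₃ => M.Y z e.2 := by
      funext e
      simp [max_eq_left (M.Y_nonneg z e.2)]
    rw [h]
    exact hu.measurable_neg.comp ((M.measurable_Y z).comp measurable_snd)
  have hprod := lintegral_prod_mul (μ := M.lawε) (ν := M.lawζ.prod M.lawη)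
    (M.measurable_β z).ennreal_ofReal.aemeasurable hm.aemeasurable
  have h1 : ∫⁻ e, ENNReal.ofReal (M.β z e) ∂M.lawε ≠ ⊤ := by
    have h := (hM.finite_β z).lintegral_lt_top.ne
    have h' := lintegral_prod_mul (μ := M.lawε) (ν := M.lawζ.prod M.lawη)
      (M.measurable_β z).ennreal_ofReal.aemeasurable
      (measurable_const (a := (1 : ℝ≥0∞))).aemeasurable
    simp only [mul_one, lintegral_const, measure_univ] at h'
    rw [← h']
    exact h
  have h2 : ∫⁻ e, (-u (M.Y z e.2)).toENNReal ∂(M.lawζ.prod M.lawη) ≠ ⊤ := by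
    have h := (hM.finite_marginal_Y z).ne
    have hme : Measurable fun e : E₂ × E₃ => marginalExt u (M.Y z e.2) :=
      measurable_marginalExt.comp ((M.measurable_Y z).comp measurable_snd)
    have h' := lintegral_prod_mul (μ := M.lawε) (ν := M.lawζ.prod M.lawη)
      (measurable_const (a := (1 : ℝ≥0∞))).aemeasurable hme.aemeasurable
    simp only [one_mul, lintegral_const, measure_univ] at h'
    have h3 : ∫⁻ e, marginalExt u (M.Y z e.2) ∂(M.lawζ.prod M.lawη) ≠ ⊤ := by
      rw [← h']
      exact h
    refine ne_top_of_le_ne_top ?_ (lintegral_mono fun e => hu.neg_le_marginalExt (M.Y z e.2))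
    rw [lintegral_add_left measurable_const]
    simp [h3]
  rw [lawInnov]
  rw [hprod]
  exact ENNReal.mul_ne_top h1 h2

lemma discountedSum_neg_incomePlan_ne_top (hu : IsInadaUtility u) (hM : SpectralConditions M u)
    {a : ℝ} (ha : 0 < a) (z : Fin n) :
    M.discountedSum (fun c => (-u c).toENNReal) z (M.incomePlan a) ≠ ⊤ := by
  have hC := M.isFeasible_incomePlan ha.le
  rw [discountedSum_eq_tsum hu.measurable_neg hC.measurable hC.nonneg,
    tsum_eq_zero_add' ENNReal.summable]
  refine ENNReal.add_ne_top.2 ⟨?_, ?_⟩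
  · simp only [discount, incomePlan]
    rw [(toENNReal_neg_of_eq_coe (hu.eq_coe ha)).2]
    simp
  · set N : ℝ≥0∞ := ∑ z', ∫⁻ e, ENNReal.ofReal (M.β z' e.1) * (-u (M.Y z' e.2.2)).toENNReal
      ∂M.lawInnov with hN
    have hN' : N ≠ ⊤ :=
      ENNReal.sum_ne_top.2 fun z' _ => lintegral_β_mul_neg_Y_ne_top hu hM z'
    refine ne_top_of_le_ne_top (ENNReal.mul_ne_top hN'
      (tsum_lintegral_discount_ne_top hM.finite_β hM.specRad_β z)) ?_
    rw [← ENNReal.tsum_mul_left]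
    refine ENNReal.tsum_le_tsum fun t => ?_
    have hg : Measurable fun s : Shock n E₁ E₂ E₃ =>
        ENNReal.ofReal (M.β s.1 s.2.1) * (-u (M.Y s.1 s.2.2.2)).toENNReal := by
      refine M.measurable_β_shock.ennreal_ofReal.mul ?_
      have h : (fun s : Shock n E₁ E₂ E₃ => (-u (M.Y s.1 s.2.2.2)).toENNReal)
          = (fun x => (-u (max x 0)).toENNReal) ∘ fun s => M.Y s.1 s.2.2.2 := by
        funext s
        simp [max_eq_left (M.Y_nonneg s.1 s.2.2.2)]
      rw [h]
      exact hu.measurable_neg.comp M.measurable_Y_shock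
    have h := M.lintegral_law_succ z t (M.measurable_discount t).ennreal_ofReal hg
    have h' : ∀ ω, ENNReal.ofReal (M.discount (t + 1) ω) *
        (-u (M.incomePlan a (t + 1) ω)).toENNReal = ENNReal.ofReal (M.discount t ω) *
        (ENNReal.ofReal (M.β (ω (t + 1)).1 (ω (t + 1)).2.1) *
          (-u (M.Y (ω (t + 1)).1 (ω (t + 1)).2.2.2)).toENNReal) := fun ω => by
      rw [discount_succ, ENNReal.ofReal_mul (M.discount_nonneg _ _), mul_assoc]
      rfl
    simp_rw [h']
    rw [h, ← lintegral_const_mul' _ _ hN']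
    refine lintegral_mono fun ω => ?_
    rw [mul_comm]
    refine mul_le_mul_left (Finset.sum_le_sum fun z' _ => ?_) _
    exact mul_le_of_le_one_left zero_le (ENNReal.ofReal_le_one.2 (M.P_le_one _ _))

/-- The expected discounted negative parts of utility are finite along a solution. -/
lemma IsSolution.discountedSum_neg_ne_top (hu : IsInadaUtility u) (hM : SpectralConditions M u)
    {a : ℝ} (ha : 0 < a) {z : Fin n} {C : ℕ → Path n E₁ E₂ E₃ → ℝ} (hC : M.IsSolution u a z C) :
    M.discountedSum (fun c => (-u c).toENNReal) z C ≠ ⊤ := by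
  intro htop
  have h := hC.2 _ (M.isFeasible_incomePlan ha.le)
  have hp := discountedSum_pos_ne_top hu hM ha.le z hC.1
  have hp' := discountedSum_pos_ne_top hu hM ha.le z (M.isFeasible_incomePlan ha.le)
  have hn' := discountedSum_neg_incomePlan_ne_top hu hM ha z
  change ((M.discountedSum (fun c => (u c).toENNReal) z (M.incomePlan a) : ℝ≥0∞) : EReal)
    - ((M.discountedSum (fun c => (-u c).toENNReal) z (M.incomePlan a) : ℝ≥0∞) : EReal)
    ≤ ((M.discountedSum (fun c => (u c).toENNReal) z C : ℝ≥0∞) : EReal)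
    - ((M.discountedSum (fun c => (-u c).toENNReal) z C : ℝ≥0∞) : EReal) at h
  rw [htop, EReal.coe_ennreal_top, EReal.sub_top, le_bot_iff] at h
  lift M.discountedSum (fun c => (u c).toENNReal) z (M.incomePlan a) to NNReal using hp' with x
  lift M.discountedSum (fun c => (-u c).toENNReal) z (M.incomePlan a) to NNReal using hn' with y
  simp only [EReal.coe_nnreal_eq_coe_real, ← EReal.coe_sub] at h
  exact EReal.coe_ne_bot _ h

/-- Separating the first two periods. -/
lemma discountedSum_eq_add_add {f : ℝ → ℝ≥0∞} (hf : Measurable fun x => f (max x 0))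
    {C : ℕ → Path n E₁ E₂ E₃ → ℝ} (hC : ∀ t, Measurable (C t)) (hC0 : ∀ t ω, 0 ≤ C t ω)
    (z : Fin n) : M.discountedSum f z C
      = ∫⁻ ω, f (C 0 ω) ∂(M.law z) + ∫⁻ ω, ENNReal.ofReal (M.βAt 1 ω) * f (C 1 ω) ∂(M.law z)
        + ∑' t, ∫⁻ ω, ENNReal.ofReal (M.discount (t + 2) ω) * f (C (t + 2) ω) ∂(M.law z) := by
  rw [discountedSum_eq_tsum hf hC hC0, tsum_eq_zero_add' ENNReal.summable,
    tsum_eq_zero_add' ENNReal.summable, ← add_assoc]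
  simp [discount]

end Values

end Model

namespace Model

variable {M : Model n E₁ E₂ E₃} {u : ℝ → EReal}

section Perturbation

/-- The change `h` of date `0` consumption, applied only if the initial state is `z`. -/
def shift (z : Fin n) (h : ℝ) (ω : Path n E₁ E₂ E₃) : ℝ := if (ω 0).1 = z then h else 0

variable (M) in
/-- Consume `h` more at date `0` and reduce consumption at date `1` accordingly; nothing is
consumed after date `0` if this is impossible. -/
def perturbed (C : ℕ → Path n E₁ E₂ E₃ → ℝ) (z : Fin n) (h : ℝ) : ℕ → Path n E₁ E₂ E₃ → ℝ
  | 0, ω => C 0 ω + shift z h ω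
  | 1, ω => if M.RAt 1 ω * shift z h ω ≤ C 1 ω then C 1 ω - M.RAt 1 ω * shift z h ω else 0
  | t + 2, ω => if M.RAt 1 ω * shift z h ω ≤ C 1 ω then C (t + 2) ω else 0

lemma measurable_shift (z : Fin n) (h : ℝ) :
    Measurable[info 0] (shift z h : Path n E₁ E₂ E₃ → ℝ) :=
  (measurable_of_finite fun z' : Fin n => if z' = z then h else 0).comp
    (measurable_fst.comp (measurable_coord le_rfl))

lemma IsFeasible.perturbed {a : ℝ} {C : ℕ → Path n E₁ E₂ E₃ → ℝ} (hC : M.IsFeasible a C)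
    {z : Fin n} {h : ℝ} (h0 : ∀ ω, (ω 0).1 = z → 0 ≤ C 0 ω + h)
    (h1 : ∀ ω, (ω 0).1 = z → C 0 ω + h ≤ a) : M.IsFeasible a (M.perturbed C z h) := by
  have hset : ∀ t, MeasurableSet[info (t + 1)]
      {ω : Path n E₁ E₂ E₃ | M.RAt 1 ω * shift z h ω ≤ C 1 ω} := fun t => by
    refine info_mono (Nat.le_add_left 1 t) _ ?_
    exact @measurableSet_le _ _ _ _ _ (info 1) _ _ _ _ _
      ((M.measurable_RAt le_rfl).mul
      ((measurable_shift z h).mono (info_mono zero_le_one) le_rfl)) (hC.adapted 1)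
  have hinit : ∀ ω, 0 ≤ C 0 ω + shift z h ω ∧ C 0 ω + shift z h ω ≤ a := fun ω => by
    unfold shift
    split_ifs with hz
    · exact ⟨h0 ω hz, h1 ω hz⟩
    · simpa using ⟨hC.nonneg 0 ω, hC.le_wealth 0 ω⟩
  have hgood : ∀ ω, M.RAt 1 ω * shift z h ω ≤ C 1 ω → ∀ t,
      M.wealth a (M.perturbed C z h) (t + 2) ω = M.wealth a C (t + 2) ω := fun ω hω t => by
    induction t with
    | zero =>
      simp only [wealth, Model.perturbed, if_pos hω]
      ring
    | succ t ih =>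
      rw [wealth, ih]
      simp only [Model.perturbed, if_pos hω]
      rfl
  have hnn : ∀ t ω, 0 ≤ M.perturbed C z h t ω := fun t ω => by
    match t with
    | 0 => exact (hinit ω).1
    | 1 =>
      simp only [Model.perturbed]
      split_ifs with hω
      · linarith
      · exact le_rfl
    | t + 2 =>
      simp only [Model.perturbed]
      split_ifs with hω
      · exact hC.nonneg _ _
      · exact le_rfl
  have hw1 : ∀ ω, 0 ≤ M.wealth a (M.perturbed C z h) 1 ω := fun ω => by
    simp only [wealth, Model.perturbed]
    exact add_nonneg (mul_nonneg (M.R_nonneg _ _) (by linarith [(hinit ω).2])) (M.Y_nonneg _ _)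
  have hbad : ∀ ω, ¬ M.RAt 1 ω * shift z h ω ≤ C 1 ω → ∀ t,
      0 ≤ M.wealth a (M.perturbed C z h) (t + 1) ω := fun ω hω t => by
    induction t with
    | zero => exact hw1 ω
    | succ t ih =>
      rw [wealth]
      refine add_nonneg (mul_nonneg (M.R_nonneg _ _) ?_) (M.Y_nonneg _ _)
      have : M.perturbed C z h (t + 1) ω = 0 := by
        cases t <;> simp only [Model.perturbed, if_neg hω]
      rw [this, sub_zero]
      exact ih
  refine ⟨fun t => ?_, hnn, fun t ω => ?_⟩
  · match t with
    | 0 => exact (hC.adapted 0).add (measurable_shift z h)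
    | 1 =>
      exact Measurable.ite (hset 0) ((hC.adapted 1).sub ((M.measurable_RAt le_rfl).mul
        ((measurable_shift z h).mono (info_mono zero_le_one) le_rfl))) measurable_const
    | t + 2 => exact Measurable.ite (hset (t + 1)) (hC.adapted (t + 2)) measurable_const
  · match t with
    | 0 => exact (hinit ω).2
    | 1 =>
      by_cases hω : M.RAt 1 ω * shift z h ω ≤ C 1 ω
      · have h2 := hC.le_wealth 1 ω
        simp only [wealth, Model.perturbed, if_pos hω] at h2 ⊢
        linarith
      · simp only [Model.perturbed, if_neg hω]
        exact hw1 ω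
    | t + 2 =>
      by_cases hω : M.RAt 1 ω * shift z h ω ≤ C 1 ω
      · rw [hgood ω hω]
        simp only [Model.perturbed, if_pos hω]
        exact hC.le_wealth _ _
      · have := hbad ω hω (t + 1)
        simp only [Model.perturbed, if_neg hω]
        exact this

/-- Optimality of `C` against a perturbation of consumption at dates `0` and `1`. -/
lemma IsSolution.perturbed_le (hu : IsInadaUtility u) (hM : SpectralConditions M u) {a : ℝ}
    (ha : 0 < a) {z : Fin n} {C : ℕ → Path n E₁ E₂ E₃ → ℝ} (hC : M.IsSolution u a z C)
    {c₀ h : ℝ} (hc₀ : ∀ ω, (ω 0).1 = z → C 0 ω = c₀) (h0 : 0 < c₀ + h) (h1 : c₀ + h ≤ a)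
    {D : Path n E₁ E₂ E₃ → ℝ} (hD : ∀ᵐ ω ∂(M.law z), C 1 ω = D ω)
    (hgood : ∀ᵐ ω ∂(M.law z), M.RAt 1 ω * h ≤ D ω)
    (hfin : ∫⁻ ω, ENNReal.ofReal (M.βAt 1 ω) * (-u (D ω - M.RAt 1 ω * h)).toENNReal
      ∂(M.law z) ≠ ⊤) :
    (u (c₀ + h)).toENNReal
        + ∫⁻ ω, ENNReal.ofReal (M.βAt 1 ω) * (u (D ω - M.RAt 1 ω * h)).toENNReal ∂(M.law z)
        + ((-u c₀).toENNReal
          + ∫⁻ ω, ENNReal.ofReal (M.βAt 1 ω) * (-u (D ω)).toENNReal ∂(M.law z))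
      ≤ (u c₀).toENNReal
        + ∫⁻ ω, ENNReal.ofReal (M.βAt 1 ω) * (u (D ω)).toENNReal ∂(M.law z)
        + ((-u (c₀ + h)).toENNReal
          + ∫⁻ ω, ENNReal.ofReal (M.βAt 1 ω) * (-u (D ω - M.RAt 1 ω * h)).toENNReal
            ∂(M.law z)) := by
  have hC' : M.IsFeasible a (M.perturbed C z h) :=
    hC.1.perturbed (fun ω hω => by rw [hc₀ ω hω]; exact h0.le)
      (fun ω hω => by rw [hc₀ ω hω]; exact h1)
  have hpos : ∀ {C : ℕ → Path n E₁ E₂ E₃ → ℝ} (_ : M.IsFeasible a C), _ := fun {C} hC =>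
    discountedSum_eq_add_add (M := M) (f := fun c => (u c).toENNReal) hu.measurable_pos
      hC.measurable hC.nonneg z
  have hneg : ∀ {C : ℕ → Path n E₁ E₂ E₃ → ℝ} (_ : M.IsFeasible a C), _ := fun {C} hC =>
    discountedSum_eq_add_add (M := M) (f := fun c => (-u c).toENNReal) hu.measurable_neg
      hC.measurable hC.nonneg z
  have hz := M.ae_state_zero z
  have e0 : ∀ f : ℝ → ℝ≥0∞, ∫⁻ ω, f (C 0 ω) ∂(M.law z) = f c₀ := fun f => by
    have : ∀ᵐ ω ∂(M.law z), f (C 0 ω) = f c₀ := by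
      filter_upwards [hz] with ω hω
      rw [hc₀ ω hω]
    rw [lintegral_congr_ae this]
    simp
  have e0' : ∀ f : ℝ → ℝ≥0∞, ∫⁻ ω, f (M.perturbed C z h 0 ω) ∂(M.law z) = f (c₀ + h) :=
      fun f => by
    have : ∀ᵐ ω ∂(M.law z), f (M.perturbed C z h 0 ω) = f (c₀ + h) := by
      filter_upwards [hz] with ω hω
      simp only [Model.perturbed, shift, if_pos hω, hc₀ ω hω]
    rw [lintegral_congr_ae this]
    simp
  have e1 : ∀ f : ℝ → ℝ≥0∞, ∫⁻ ω, ENNReal.ofReal (M.βAt 1 ω) * f (C 1 ω) ∂(M.law z)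
      = ∫⁻ ω, ENNReal.ofReal (M.βAt 1 ω) * f (D ω) ∂(M.law z) := fun f => by
    refine lintegral_congr_ae ?_
    filter_upwards [hD] with ω hω
    rw [hω]
  have e1' : ∀ f : ℝ → ℝ≥0∞,
      ∫⁻ ω, ENNReal.ofReal (M.βAt 1 ω) * f (M.perturbed C z h 1 ω) ∂(M.law z)
      = ∫⁻ ω, ENNReal.ofReal (M.βAt 1 ω) * f (D ω - M.RAt 1 ω * h) ∂(M.law z) := fun f => by
    refine lintegral_congr_ae ?_
    filter_upwards [hD, hgood, hz] with ω hω hg hz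
    simp only [Model.perturbed, shift, if_pos hz, hω, if_pos hg]
  have e2' : ∀ f : ℝ → ℝ≥0∞, ∑' t, ∫⁻ ω, ENNReal.ofReal (M.discount (t + 2) ω) *
      f (M.perturbed C z h (t + 2) ω) ∂(M.law z)
      = ∑' t, ∫⁻ ω, ENNReal.ofReal (M.discount (t + 2) ω) * f (C (t + 2) ω) ∂(M.law z) :=
      fun f => by
    refine tsum_congr fun t => lintegral_congr_ae ?_
    filter_upwards [hD, hgood, hz] with ω hω hg hz
    simp only [Model.perturbed, shift, if_pos hz, hω, if_pos hg]
  have hp := discountedSum_pos_ne_top hu hM ha.le z hC.1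
  have hp' := discountedSum_pos_ne_top hu hM ha.le z hC'
  have hn := hC.discountedSum_neg_ne_top hu hM ha
  have hopt := hC.2 _ hC'
  have hn' : M.discountedSum (fun c => (-u c).toENNReal) z (M.perturbed C z h) ≠ ⊤ := by
    rw [hneg hC.1] at hn
    rw [hneg hC', e0' (fun c => (-u c).toENNReal),
      e1' (fun c => (-u c).toENNReal), e2' (fun c => (-u c).toENNReal)]
    refine ENNReal.add_ne_top.2 ⟨ENNReal.add_ne_top.2 ⟨?_, hfin⟩, (ENNReal.add_ne_top.1 hn).2⟩
    rw [(toENNReal_neg_of_eq_coe (hu.eq_coe h0)).2]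
    exact ENNReal.ofReal_ne_top
  have key := add_le_add_of_coe_sub_le hp hn hp' hn' hopt
  rw [hpos hC.1] at hp
  rw [hneg hC.1] at hn
  rw [hpos hC.1, hneg hC.1, hpos hC',
    hneg hC', e0 (fun c => (-u c).toENNReal), e0 (fun c => (u c).toENNReal),
    e0' (fun c => (-u c).toENNReal), e0' (fun c => (u c).toENNReal),
    e1 (fun c => (-u c).toENNReal), e1 (fun c => (u c).toENNReal),
    e1' (fun c => (-u c).toENNReal), e1' (fun c => (u c).toENNReal),
    e2' (fun c => (-u c).toENNReal), e2' (fun c => (u c).toENNReal)] at key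
  have hp2 := (ENNReal.add_ne_top.1 hp).2
  have hn2 := (ENNReal.add_ne_top.1 hn).2
  rw [add_add_add_comm, add_add_add_comm (_ + _) _ (_ + _) _] at key
  exact (ENNReal.add_le_add_iff_right (ENNReal.add_ne_top.2 ⟨hp2, hn2⟩)).1 key

end Perturbation

end Model

namespace Model

variable {M : Model n E₁ E₂ E₃} {u : ℝ → EReal} {c : ℝ → Fin n → ℝ}

section Euler

lemma ae_law_one (z : Fin n) {S : Set (Shock n E₁ E₂ E₃)} (hS : MeasurableSet S)
    (h : ∀ z', ∀ᵐ e ∂M.lawInnov, (z', e) ∈ S) : ∀ᵐ ω ∂(M.law z), ω 1 ∈ S := by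
  have h1 := M.lintegral_law_one z (measurable_one.indicator hS.compl)
  have h2 : ∀ z', ∫⁻ e, Sᶜ.indicator (1 : Shock n E₁ E₂ E₃ → ℝ≥0∞) (z', e) ∂M.lawInnov = 0 :=
    fun z' => by
      rw [lintegral_eq_zero_of_ae_eq_zero]
      filter_upwards [h z'] with e he
      simp [he]
  simp only [h2, mul_zero, Finset.sum_const_zero] at h1
  have hm : Measurable fun ω : Path n E₁ E₂ E₃ =>
      Sᶜ.indicator (1 : Shock n E₁ E₂ E₃ → ℝ≥0∞) (ω 1) :=
    (measurable_one.indicator hS.compl).comp ((measurable_coord le_rfl).mono (info_le 1) le_rfl)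
  rw [lintegral_eq_zero_iff hm] at h1
  filter_upwards [h1] with ω hω
  by_contra hcon
  simp [hcon] at hω

variable (M c) in
/-- Consumption tomorrow when today's wealth and state are `a` and `z`. -/
def nextC (a : ℝ) (z : Fin n) (s : Shock n E₁ E₂ E₃) : ℝ :=
  c (M.R s.1 s.2.2.1 * (a - c a z) + M.Y s.1 s.2.2.2) s.1

lemma IsConsumptionFunction.measurable_nextC (hc : M.IsConsumptionFunction u c) (a : ℝ)
    (z : Fin n) : Measurable (M.nextC c a z) :=
  measurable_shock_iff fun z' => (hc.measurable z').comp
    ((((M.measurable_R z').comp (measurable_fst.comp measurable_snd)).mul_const _).add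
      ((M.measurable_Y z').comp (measurable_snd.comp measurable_snd)))

lemma IsConsumptionFunction.nextC_nonneg (hc : M.IsConsumptionFunction u c) {a : ℝ} (ha : 0 ≤ a)
    (z : Fin n) (s : Shock n E₁ E₂ E₃) : 0 ≤ M.nextC c a z s :=
  hc.nonneg _ (add_nonneg (mul_nonneg (M.R_nonneg _ _) (by linarith [hc.le_self a ha z]))
    (M.Y_nonneg _ _)) _

lemma ae_policyPlan_one (a : ℝ) (z : Fin n) :
    ∀ᵐ ω ∂(M.law z), M.policyPlan c a 1 ω = M.nextC c a z (ω 1) := by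
  filter_upwards [M.ae_state_zero z] with ω hω
  simp [policyPlan, policyWealth, nextC, hω, RAt, YAt]

lemma measurable_coord_one : Measurable fun ω : Path n E₁ E₂ E₃ => ω 1 :=
  (measurable_coord le_rfl).mono (info_le 1) le_rfl

lemma measurable_discounted_pos (hu : IsInadaUtility u) {D : Path n E₁ E₂ E₃ → ℝ}
    (hD : Measurable D) (hD0 : ∀ ω, 0 ≤ D ω) :
    Measurable fun ω => ENNReal.ofReal (M.βAt 1 ω) * (u (D ω)).toENNReal := by
  refine ((M.measurable_βAt le_rfl).mono (info_le 1) le_rfl).ennreal_ofReal.mul ?_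
  have h : (fun ω => (u (D ω)).toENNReal) = (fun x => (u (max x 0)).toENNReal) ∘ D := by
    funext ω
    simp [max_eq_left (hD0 ω)]
  rw [h]
  exact hu.measurable_pos.comp hD

lemma measurable_discounted_neg (hu : IsInadaUtility u) {D : Path n E₁ E₂ E₃ → ℝ}
    (hD : Measurable D) (hD0 : ∀ ω, 0 ≤ D ω) :
    Measurable fun ω => ENNReal.ofReal (M.βAt 1 ω) * (-u (D ω)).toENNReal := by
  refine ((M.measurable_βAt le_rfl).mono (info_le 1) le_rfl).ennreal_ofReal.mul ?_
  have h : (fun ω => (-u (D ω)).toENNReal) = (fun x => (-u (max x 0)).toENNReal) ∘ D := by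
    funext ω
    simp [max_eq_left (hD0 ω)]
  rw [h]
  exact hu.measurable_neg.comp hD

/-- First-period expected utilities along the solution are finite. -/
lemma IsConsumptionFunction.lintegral_nextC_ne_top (hu : IsInadaUtility u)
    (hM : SpectralConditions M u) (hc : M.IsConsumptionFunction u c) {a : ℝ} (ha : 0 < a)
    (z : Fin n) :
    ((u (c a z)).toENNReal ≠ ⊤ ∧
      ∫⁻ ω, ENNReal.ofReal (M.βAt 1 ω) * (u (M.nextC c a z (ω 1))).toENNReal ∂(M.law z) ≠ ⊤) ∧
    ((-u (c a z)).toENNReal ≠ ⊤ ∧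
      ∫⁻ ω, ENNReal.ofReal (M.βAt 1 ω) * (-u (M.nextC c a z (ω 1))).toENNReal ∂(M.law z) ≠ ⊤) := by
  have hC := hc.optimal a ha z
  have e0 : ∀ f : ℝ → ℝ≥0∞, ∫⁻ ω, f (M.policyPlan c a 0 ω) ∂(M.law z) = f (c a z) := fun f => by
    have : ∀ᵐ ω ∂(M.law z), f (M.policyPlan c a 0 ω) = f (c a z) := by
      filter_upwards [M.ae_state_zero z] with ω hω
      simp [policyPlan, policyWealth, hω]
    rw [lintegral_congr_ae this]
    simp
  have e1 : ∀ f : ℝ → ℝ≥0∞,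
      ∫⁻ ω, ENNReal.ofReal (M.βAt 1 ω) * f (M.policyPlan c a 1 ω) ∂(M.law z)
      = ∫⁻ ω, ENNReal.ofReal (M.βAt 1 ω) * f (M.nextC c a z (ω 1)) ∂(M.law z) := fun f => by
    refine lintegral_congr_ae ?_
    filter_upwards [M.ae_policyPlan_one a z] with ω hω
    rw [hω]
  have hp := discountedSum_pos_ne_top hu hM ha.le z hC.1
  have hn := hC.discountedSum_neg_ne_top hu hM ha
  rw [discountedSum_eq_add_add hu.measurable_pos hC.1.measurable hC.1.nonneg,
    e0 fun c => (u c).toENNReal, e1 fun c => (u c).toENNReal] at hp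
  rw [discountedSum_eq_add_add hu.measurable_neg hC.1.measurable hC.1.nonneg,
    e0 fun c => (-u c).toENNReal, e1 fun c => (-u c).toENNReal] at hn
  exact ⟨ENNReal.add_ne_top.1 (ENNReal.add_ne_top.1 hp).1,
    ENNReal.add_ne_top.1 (ENNReal.add_ne_top.1 hn).1⟩

variable (M) in
lemma lintegral_marginal_eq (z : Fin n) {k : ℝ} (hk : 0 < k)
    {D : Shock n E₁ E₂ E₃ → ℝ} (hD : Measurable D) :
    ∫⁻ ω, ENNReal.ofReal (M.βAt 1 ω) *
        ENNReal.ofReal (M.RAt 1 ω * k * marginal u (D (ω 1))) ∂(M.law z)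
      = ENNReal.ofReal k * ∑ z', ENNReal.ofReal (M.P z z') *
        ∫⁻ e, ENNReal.ofReal (M.varβR z' e * marginal u (D (z', e))) ∂M.lawInnov := by
  have hg : Measurable fun s : Shock n E₁ E₂ E₃ =>
      ENNReal.ofReal (M.varβR s.1 s.2 * marginal u (D s)) :=
    ((measurable_shock_iff M.measurable_varβR).mul (measurable_marginal.comp hD)).ennreal_ofReal
  rw [← M.lintegral_law_one z hg, ← lintegral_const_mul' _ _ ENNReal.ofReal_ne_top]
  refine lintegral_congr fun ω => ?_
  rw [← ENNReal.ofReal_mul (show 0 ≤ M.βAt 1 ω from M.β_nonneg _ _), ← ENNReal.ofReal_mul hk.le]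
  congr 1
  simp only [βAt, RAt, varβR]
  ring

/-- Saving slightly more is not profitable. -/
theorem IsConsumptionFunction.euler_save (hu : IsInadaUtility u) (hM : SpectralConditions M u)
    (hc : M.IsConsumptionFunction u c) {a k : ℝ} (ha : 0 < a) {z : Fin n} (hk : 0 < k)
    (hkc : k < c a z) :
    ∑ z', ENNReal.ofReal (M.P z z') * ∫⁻ e, ENNReal.ofReal (M.varβR z' e *
        marginal u (M.nextC c a z (z', e) + M.R z' e.2.1 * k)) ∂M.lawInnov
      ≤ ENNReal.ofReal (marginal u (c a z - k)) := by
  obtain ⟨⟨hp0, hp1⟩, -, hn1⟩ := hc.lintegral_nextC_ne_top hu hM ha z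
  set D : Path n E₁ E₂ E₃ → ℝ := fun ω => M.nextC c a z (ω 1)
  have hD0 : ∀ ω, 0 ≤ D ω := fun ω => hc.nextC_nonneg ha.le z _
  have hDm : Measurable D := (hc.measurable_nextC a z).comp measurable_coord_one
  have hRm : Measurable (M.RAt 1) := (M.measurable_RAt le_rfl).mono (info_le 1) le_rfl
  have hR0 : ∀ ω, 0 ≤ M.RAt 1 ω := fun ω => M.R_nonneg _ _
  have hD'0 : ∀ ω, 0 ≤ D ω + M.RAt 1 ω * k := fun ω =>
    add_nonneg (hD0 ω) (mul_nonneg (hR0 ω) hk.le)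
  have hD'm : Measurable fun ω => D ω + M.RAt 1 ω * k := hDm.add (hRm.mul_const k)
  have hsub : ∀ ω, D ω - M.RAt 1 ω * -k = D ω + M.RAt 1 ω * k := fun ω => by ring
  have hfin : ∫⁻ ω, ENNReal.ofReal (M.βAt 1 ω) * (-u (D ω + M.RAt 1 ω * k)).toENNReal
      ∂(M.law z) ≠ ⊤ := by
    refine ne_top_of_le_ne_top hn1 (lintegral_mono fun ω => ?_)
    refine mul_le_mul_right (EReal.toENNReal_le_toENNReal (EReal.neg_le_neg_iff.2 ?_)) _
    exact hu.mono (hD0 ω) (by linarith [mul_nonneg (hR0 ω) hk.le])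
  have hopt := (hc.optimal a ha z).perturbed_le hu hM ha (c₀ := c a z) (h := -k) (D := D)
    (fun ω hω => by simp [policyPlan, policyWealth, hω]) (by linarith)
    (by linarith [hc.le_self a ha.le z]) (M.ae_policyPlan_one a z)
    (ae_of_all _ fun ω => by nlinarith [hD0 ω, mul_nonneg (hR0 ω) hk.le])
    (by simpa only [hsub] using hfin)
  simp only [hsub, ← sub_eq_add_neg] at hopt
  have h0 := hu.gain_upper (x := c a z) (y := c a z - k) (by linarith) (by linarith)
  rw [sub_sub_cancel] at h0
  have h1 : ∫⁻ ω, ENNReal.ofReal (M.βAt 1 ω) * (u (D ω)).toENNReal ∂(M.law z)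
      + ∫⁻ ω, ENNReal.ofReal (M.βAt 1 ω) * (-u (D ω + M.RAt 1 ω * k)).toENNReal ∂(M.law z)
      + ∫⁻ ω, ENNReal.ofReal (M.βAt 1 ω) *
        ENNReal.ofReal (M.RAt 1 ω * k * marginal u (D ω + M.RAt 1 ω * k)) ∂(M.law z)
      ≤ ∫⁻ ω, ENNReal.ofReal (M.βAt 1 ω) * (u (D ω + M.RAt 1 ω * k)).toENNReal ∂(M.law z)
      + ∫⁻ ω, ENNReal.ofReal (M.βAt 1 ω) * (-u (D ω)).toENNReal ∂(M.law z) := by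
    have m1 := measurable_discounted_pos (M := M) hu hDm hD0
    have m2 := measurable_discounted_neg (M := M) hu hD'm hD'0
    have m3 := measurable_discounted_pos (M := M) hu hD'm hD'0
    rw [← lintegral_add_left m1, ← lintegral_add_left (m1.fun_add m2), ← lintegral_add_left m3]
    refine lintegral_mono fun ω => ?_
    simp only [← mul_add]
    refine mul_le_mul_right ?_ _
    have := hu.gain_lower (hD0 ω) (show D ω ≤ D ω + M.RAt 1 ω * k by
      linarith [mul_nonneg (hR0 ω) hk.le])
    rwa [add_sub_cancel_left] at this
  have hJeq : ∫⁻ ω, ENNReal.ofReal (M.βAt 1 ω) *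
        ENNReal.ofReal (M.RAt 1 ω * k * marginal u (D ω + M.RAt 1 ω * k)) ∂(M.law z) = _ :=
    M.lintegral_marginal_eq z hk (D := fun s => M.nextC c a z s + M.R s.1 s.2.2.1 * k)
      ((hc.measurable_nextC a z).add (M.measurable_R_shock.mul_const k))
  rw [hJeq] at h1
  set J := ∑ z', ENNReal.ofReal (M.P z z') * ∫⁻ e, ENNReal.ofReal (M.varβR z' e *
        marginal u (M.nextC c a z (z', e) + M.R z' e.2.1 * k)) ∂M.lawInnov
  rw [ENNReal.ofReal_mul hk.le] at h0
  set P1 := ∫⁻ ω, ENNReal.ofReal (M.βAt 1 ω) * (u (D ω)).toENNReal ∂(M.law z)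
  set N1 := ∫⁻ ω, ENNReal.ofReal (M.βAt 1 ω) * (-u (D ω)).toENNReal ∂(M.law z)
  set P1' := ∫⁻ ω, ENNReal.ofReal (M.βAt 1 ω) * (u (D ω + M.RAt 1 ω * k)).toENNReal ∂(M.law z)
  set N1' := ∫⁻ ω, ENNReal.ofReal (M.βAt 1 ω) * (-u (D ω + M.RAt 1 ω * k)).toENNReal ∂(M.law z)
  have hn0' : (-u (c a z - k)).toENNReal ≠ ⊤ := by
    rw [(toENNReal_neg_of_eq_coe (hu.eq_coe (show 0 < c a z - k by linarith))).2]
    exact ENNReal.ofReal_ne_top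
  have hT : (u (c a z)).toENNReal + P1 + ((-u (c a z - k)).toENNReal + N1') ≠ ⊤ := by
    simp only [ENNReal.add_ne_top]
    exact ⟨⟨hp0, hp1⟩, hn0', hfin⟩
  have hfinal : (u (c a z)).toENNReal + P1 + ((-u (c a z - k)).toENNReal + N1')
        + ENNReal.ofReal k * J
      ≤ (u (c a z)).toENNReal + P1 + ((-u (c a z - k)).toENNReal + N1')
        + ENNReal.ofReal k * ENNReal.ofReal (marginal u (c a z - k)) := by
    calc (u (c a z)).toENNReal + P1 + ((-u (c a z - k)).toENNReal + N1') + ENNReal.ofReal k * J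
        = ((u (c a z)).toENNReal + (-u (c a z - k)).toENNReal)
          + (P1 + N1' + ENNReal.ofReal k * J) := by ring
      _ ≤ _ + _ := add_le_add h0 h1
      _ = ((u (c a z - k)).toENNReal + P1' + ((-u (c a z)).toENNReal + N1))
          + ENNReal.ofReal k * ENNReal.ofReal (marginal u (c a z - k)) := by ring
      _ ≤ _ := add_le_add_left hopt _
  have h2 := (ENNReal.add_le_add_iff_left hT).1 hfinal
  exact (ENNReal.mul_le_mul_iff_right (by simpa using hk) ENNReal.ofReal_ne_top).1 h2

/-- Saving slightly less is not profitable. -/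
theorem IsConsumptionFunction.euler_dissave (hu : IsInadaUtility u) (hM : SpectralConditions M u)
    (hc : M.IsConsumptionFunction u c) {a k m : ℝ} (ha : 0 < a) {z : Fin n} (hk : 0 < k)
    (hkc : c a z + k ≤ a) (hm : 0 < m)
    (hR : ∀ z', ∀ᵐ e ∂M.lawInnov, M.R z' e.2.1 = 0 ∨
      m ≤ M.nextC c a z (z', e) - M.R z' e.2.1 * k) :
    ENNReal.ofReal (marginal u (c a z + k)) ≤
      ∑ z', ENNReal.ofReal (M.P z z') * ∫⁻ e, ENNReal.ofReal (M.varβR z' e *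
        marginal u (M.nextC c a z (z', e) - M.R z' e.2.1 * k)) ∂M.lawInnov := by
  obtain ⟨⟨hp0, hp1⟩, -, hn1⟩ := hc.lintegral_nextC_ne_top hu hM ha z
  set D : Path n E₁ E₂ E₃ → ℝ := fun ω => M.nextC c a z (ω 1)
  have hD0 : ∀ ω, 0 ≤ D ω := fun ω => hc.nextC_nonneg ha.le z _
  have hDm : Measurable D := (hc.measurable_nextC a z).comp measurable_coord_one
  have hβm : Measurable fun ω => ENNReal.ofReal (M.βAt 1 ω) :=
    ((M.measurable_βAt le_rfl).mono (info_le 1) le_rfl).ennreal_ofReal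
  have hRm : Measurable (M.RAt 1) := (M.measurable_RAt le_rfl).mono (info_le 1) le_rfl
  have hR0 : ∀ ω, 0 ≤ M.RAt 1 ω := fun ω => M.R_nonneg _ _
  have hD'm : Measurable fun ω => D ω - M.RAt 1 ω * k := hDm.sub (hRm.mul_const k)
  have hgood : ∀ᵐ ω ∂(M.law z), M.RAt 1 ω = 0 ∨ m ≤ D ω - M.RAt 1 ω * k := by
    refine ae_law_one z (S := {s | M.R s.1 s.2.2.1 = 0 ∨
      m ≤ M.nextC c a z s - M.R s.1 s.2.2.1 * k}) ?_ hR
    exact (M.measurable_R_shock (measurableSet_singleton 0)).union (measurableSet_le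
      measurable_const ((hc.measurable_nextC a z).sub (M.measurable_R_shock.mul_const k)))
  have hD'0 : ∀ᵐ ω ∂(M.law z), 0 ≤ D ω - M.RAt 1 ω * k := by
    filter_upwards [hgood] with ω hω
    rcases hω with h | h
    · simpa [h] using hD0 ω
    · linarith
  have hJ : ∫⁻ ω, ENNReal.ofReal (M.βAt 1 ω) *
        ENNReal.ofReal (M.RAt 1 ω * k * marginal u (D ω - M.RAt 1 ω * k)) ∂(M.law z) ≠ ⊤ := by
    have hb := M.lintegral_marginal_eq (u := u) z hk (D := fun _ => m) measurable_const
    have hfin : ∀ z', ∫⁻ e, ENNReal.ofReal (M.varβR z' e * marginal u m) ∂M.lawInnov ≠ ⊤ :=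
      fun z' => ((hM.finite_βR z').mul_const _).lintegral_lt_top.ne
    refine ne_top_of_le_ne_top (b := ∫⁻ ω, ENNReal.ofReal (M.βAt 1 ω) *
      ENNReal.ofReal (M.RAt 1 ω * k * marginal u m) ∂(M.law z)) ?_ (lintegral_mono_ae ?_)
    · rw [hb]
      exact ENNReal.mul_ne_top ENNReal.ofReal_ne_top (ENNReal.sum_ne_top.2 fun z' _ =>
        ENNReal.mul_ne_top ENNReal.ofReal_ne_top (hfin z'))
    · filter_upwards [hgood] with ω hω
      refine mul_le_mul_right (ENNReal.ofReal_le_ofReal ?_) _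
      rcases hω with h | h
      · simp [h]
      · exact mul_le_mul_of_nonneg_left (hu.marginal_anti hm h) (mul_nonneg (hR0 ω) hk.le)
  have hup : ∀ᵐ ω ∂(M.law z), (u (D ω)).toENNReal + (-u (D ω - M.RAt 1 ω * k)).toENNReal
      ≤ (u (D ω - M.RAt 1 ω * k)).toENNReal + (-u (D ω)).toENNReal
        + ENNReal.ofReal (M.RAt 1 ω * k * marginal u (D ω - M.RAt 1 ω * k)) := by
    filter_upwards [hgood] with ω hω
    rcases hω with h | h
    · simp [h]
    · have := hu.gain_upper (hm.trans_le h) (show D ω - M.RAt 1 ω * k ≤ D ω by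
        linarith [mul_nonneg (hR0 ω) hk.le])
      rwa [sub_sub_cancel] at this
  have hfin : ∫⁻ ω, ENNReal.ofReal (M.βAt 1 ω) * (-u (D ω - M.RAt 1 ω * k)).toENNReal
      ∂(M.law z) ≠ ⊤ := by
    refine ne_top_of_le_ne_top (ENNReal.add_ne_top.2 ⟨hn1, hJ⟩) ?_
    rw [← lintegral_add_left (measurable_discounted_neg (M := M) hu hDm hD0)]
    refine lintegral_mono_ae ?_
    filter_upwards [hup] with ω hω
    rw [← mul_add]
    refine mul_le_mul_right ?_ _
    rcases le_total 0 (u (D ω - M.RAt 1 ω * k)) with h | h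
    · rw [EReal.toENNReal_of_nonpos (x := -u (D ω - M.RAt 1 ω * k)) (by simpa using h)]
      exact zero_le
    · rw [EReal.toENNReal_of_nonpos h, zero_add] at hω
      exact le_add_self.trans hω
  have hopt := (hc.optimal a ha z).perturbed_le hu hM ha (c₀ := c a z) (h := k) (D := D)
    (fun ω hω => by simp [policyPlan, policyWealth, hω])
    (by linarith [hc.nonneg a ha.le z]) hkc (M.ae_policyPlan_one a z)
    (by filter_upwards [hD'0] with ω hω; linarith) hfin
  have h0 := hu.gain_lower (x := c a z + k) (y := c a z) (hc.nonneg a ha.le z) (by linarith)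
  rw [add_sub_cancel_left] at h0
  have h1 : ∫⁻ ω, ENNReal.ofReal (M.βAt 1 ω) * (u (D ω)).toENNReal ∂(M.law z)
      + ∫⁻ ω, ENNReal.ofReal (M.βAt 1 ω) * (-u (D ω - M.RAt 1 ω * k)).toENNReal ∂(M.law z)
      ≤ ∫⁻ ω, ENNReal.ofReal (M.βAt 1 ω) * (u (D ω - M.RAt 1 ω * k)).toENNReal ∂(M.law z)
      + ∫⁻ ω, ENNReal.ofReal (M.βAt 1 ω) * (-u (D ω)).toENNReal ∂(M.law z)
      + ∫⁻ ω, ENNReal.ofReal (M.βAt 1 ω) *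
        ENNReal.ofReal (M.RAt 1 ω * k * marginal u (D ω - M.RAt 1 ω * k)) ∂(M.law z) := by
    have m1 := measurable_discounted_pos (M := M) hu hDm hD0
    have m2 := measurable_discounted_neg (M := M) hu hDm hD0
    have m3 : Measurable fun ω => ENNReal.ofReal (M.βAt 1 ω) *
        ENNReal.ofReal (M.RAt 1 ω * k * marginal u (D ω - M.RAt 1 ω * k)) :=
      hβm.mul ((hRm.mul_const k).mul (measurable_marginal.comp hD'm)).ennreal_ofReal
    rw [← lintegral_add_left m1, ← lintegral_add_right _ m2, ← lintegral_add_right _ m3]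
    refine lintegral_mono_ae ?_
    filter_upwards [hup] with ω hω
    simp only [← mul_add]
    exact mul_le_mul_right hω _
  have hJeq : ∫⁻ ω, ENNReal.ofReal (M.βAt 1 ω) *
        ENNReal.ofReal (M.RAt 1 ω * k * marginal u (D ω - M.RAt 1 ω * k)) ∂(M.law z) = _ :=
    M.lintegral_marginal_eq z hk (D := fun s => M.nextC c a z s - M.R s.1 s.2.2.1 * k)
      ((hc.measurable_nextC a z).sub (M.measurable_R_shock.mul_const k))
  rw [hJeq] at h1
  set J := ∑ z', ENNReal.ofReal (M.P z z') * ∫⁻ e, ENNReal.ofReal (M.varβR z' e *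
        marginal u (M.nextC c a z (z', e) - M.R z' e.2.1 * k)) ∂M.lawInnov
  rw [ENNReal.ofReal_mul hk.le] at h0
  set P1 := ∫⁻ ω, ENNReal.ofReal (M.βAt 1 ω) * (u (D ω)).toENNReal ∂(M.law z)
  set N1 := ∫⁻ ω, ENNReal.ofReal (M.βAt 1 ω) * (-u (D ω)).toENNReal ∂(M.law z)
  set P1' := ∫⁻ ω, ENNReal.ofReal (M.βAt 1 ω) * (u (D ω - M.RAt 1 ω * k)).toENNReal ∂(M.law z)
  set N1' := ∫⁻ ω, ENNReal.ofReal (M.βAt 1 ω) * (-u (D ω - M.RAt 1 ω * k)).toENNReal ∂(M.law z)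
  have hn0' : (-u (c a z + k)).toENNReal ≠ ⊤ := by
    rw [(toENNReal_neg_of_eq_coe (hu.eq_coe (show 0 < c a z + k by
      linarith [hc.nonneg a ha.le z]))).2]
    exact ENNReal.ofReal_ne_top
  have hT : (u (c a z)).toENNReal + P1 + ((-u (c a z + k)).toENNReal + N1') ≠ ⊤ := by
    simp only [ENNReal.add_ne_top]
    exact ⟨⟨hp0, hp1⟩, hn0', hfin⟩
  have hfinal : (u (c a z)).toENNReal + P1 + ((-u (c a z + k)).toENNReal + N1')
        + ENNReal.ofReal k * ENNReal.ofReal (marginal u (c a z + k))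
      ≤ (u (c a z)).toENNReal + P1 + ((-u (c a z + k)).toENNReal + N1')
        + ENNReal.ofReal k * J := by
    calc (u (c a z)).toENNReal + P1 + ((-u (c a z + k)).toENNReal + N1')
          + ENNReal.ofReal k * ENNReal.ofReal (marginal u (c a z + k))
        = ((u (c a z)).toENNReal + (-u (c a z + k)).toENNReal
          + ENNReal.ofReal k * ENNReal.ofReal (marginal u (c a z + k))) + (P1 + N1') := by ring
      _ ≤ _ + _ := add_le_add h0 h1
      _ = ((u (c a z + k)).toENNReal + P1' + ((-u (c a z)).toENNReal + N1))
          + ENNReal.ofReal k * J := by ring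
      _ ≤ _ := add_le_add_left hopt _
  have h2 := (ENNReal.add_le_add_iff_left hT).1 hfinal
  exact (ENNReal.mul_le_mul_iff_right (by simpa using hk) ENNReal.ofReal_ne_top).1 h2

end Euler

end Model

variable {M : Model n E₁ E₂ E₃} {u : ℝ → EReal} {c : ℝ → Fin n → ℝ} {γ : ℝ}

section Moments

lemma ae_return {δ : ℝ} (hR : ∀ z, ∀ᵐ e ∂M.lawζ, M.R z e = 0 ∨ δ ≤ M.R z e) (z : Fin n) :
    ∀ᵐ e ∂M.lawInnov, M.R z e.2.1 = 0 ∨ δ ≤ M.R z e.2.1 :=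
  (Measure.quasiMeasurePreserving_snd (μ := M.lawε) (ν := M.lawζ.prod M.lawη)).ae
    ((Measure.quasiMeasurePreserving_fst (μ := M.lawζ) (ν := M.lawη)).ae (hR z))

lemma varβRγ_nonneg (z : Fin n) (e : E₁ × E₂ × E₃) : 0 ≤ M.varβRγ γ z e :=
  mul_nonneg (mul_nonneg (M.β_nonneg _ _) (M.R_nonneg _ _)) (Real.rpow_nonneg (M.R_nonneg _ _) _)

lemma varβR_nonneg (z : Fin n) (e : E₁ × E₂ × E₃) : 0 ≤ M.varβR z e :=
  mul_nonneg (M.β_nonneg _ _) (M.R_nonneg _ _)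

lemma measurable_varβR_shock : Measurable fun s : Shock n E₁ E₂ E₃ => M.varβR s.1 s.2 :=
  Model.measurable_shock_iff M.measurable_varβR

lemma measurable_varβRγ (z : Fin n) : Measurable (M.varβRγ γ z) :=
  (M.measurable_varβR z).mul
    (((M.measurable_R z).comp (measurable_fst.comp measurable_snd)).pow_const (-γ))

lemma finiteMean_varβRγ (hγ : 0 < γ) (hβR : ∀ z, M.FiniteMean M.varβR z)
    (hR : ReturnZeroOrBoundedBelow M) (z : Fin n) : M.FiniteMean (M.varβRγ γ) z := by
  obtain ⟨δ, hδ, hR⟩ := hR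
  refine Integrable.mono' ((hβR z).mul_const (δ ^ (-γ)))
    (measurable_varβRγ z).aestronglyMeasurable ?_
  filter_upwards [ae_return hR z] with e he
  rw [Real.norm_of_nonneg (varβRγ_nonneg z e)]
  rcases he with h | h
  · simp [Model.varβRγ, Model.varβR, h]
  · exact mul_le_mul_of_nonneg_left
      (Real.rpow_le_rpow_of_nonpos hδ h (by linarith)) (varβR_nonneg z e)

lemma matPD_nonneg (i j : Fin n) : 0 ≤ matPD M γ i j := M.mul_diag_nonneg varβRγ_nonneg i j

lemma varβR_mul_rpow {z : Fin n} {e : E₁ × E₂ × E₃} {d : ℝ} (hd : 0 ≤ d) :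
    M.varβR z e * (M.R z e.2.1 * d) ^ (-γ) = M.varβRγ γ z e * d ^ (-γ) := by
  rw [Real.mul_rpow (M.R_nonneg _ _) hd, ← mul_assoc]
  rfl

lemma lintegral_law_varβRγ (hint : ∀ z, M.FiniteMean (M.varβRγ γ) z) (z : Fin n) {d : Fin n → ℝ}
    (hd : ∀ z', 0 ≤ d z') :
    ∫⁻ ω, ENNReal.ofReal (M.varβRγ γ (ω 1).1 (ω 1).2 * d (ω 1).1) ∂(M.law z)
      = ENNReal.ofReal ((matPD M γ).mulVec d z) := by
  rw [M.lintegral_law_one z (g := fun s => ENNReal.ofReal (M.varβRγ γ s.1 s.2 * d s.1))]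
  · exact M.sum_lintegral_ofReal_mul varβRγ_nonneg hint hd z
  · exact Model.measurable_shock_iff fun z' =>
      ((measurable_varβRγ z').mul_const (d z')).ennreal_ofReal

end Moments

section Asymptotics

/-- Dividing a bound between expected marginal utilities by marginal utility of wealth. -/
lemma sum_lintegral_div_eq (z : Fin n) {g : Shock n E₁ E₂ E₃ → ℝ} (hg : Measurable g) {m : ℝ}
    (hm : 0 < m) :
    ∫⁻ ω, ENNReal.ofReal (M.varβR (ω 1).1 (ω 1).2 * (g (ω 1) / m)) ∂(M.law z)
      = (∑ z', ENNReal.ofReal (M.P z z') *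
        ∫⁻ e, ENNReal.ofReal (M.varβR z' e * g (z', e)) ∂M.lawInnov) / ENNReal.ofReal m := by
  have h1 : Measurable fun s : Shock n E₁ E₂ E₃ => ENNReal.ofReal (M.varβR s.1 s.2 * g s) :=
    (measurable_varβR_shock.mul hg).ennreal_ofReal
  rw [← M.lintegral_law_one z h1, div_eq_mul_inv,
    ← lintegral_mul_const' _ _ (by simpa using hm)]
  refine lintegral_congr fun ω => ?_
  rw [← div_eq_mul_inv, ← ENNReal.ofReal_div_of_pos hm, mul_div_assoc]

lemma measurable_varβR_mul {g : Shock n E₁ E₂ E₃ → ℝ} (hg : Measurable g) (m : ℝ) :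
    Measurable fun ω : Path n E₁ E₂ E₃ =>
      ENNReal.ofReal (M.varβR (ω 1).1 (ω 1).2 * (g (ω 1) / m)) := by
  have h : Measurable fun s : Shock n E₁ E₂ E₃ => ENNReal.ofReal (M.varβR s.1 s.2 * (g s / m)) :=
    (measurable_varβR_shock.mul (hg.div_const m)).ennreal_ofReal
  exact h.comp Model.measurable_coord_one

lemma mulVec_le_of_frequently_ge (hu : IsInadaUtility u)
    (hM : SpectralConditions M u) (hrv : IsRegularlyVarying (marginal u) (-γ))
    (hint : ∀ z, M.FiniteMean (M.varβRγ γ) z) (hc : M.IsConsumptionFunction u c)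
    {b : Fin n → ℝ} (hb : ∀ z, 0 ≤ b z) (hev : ∀ z, ∀ᶠ a in atTop, c a z ≤ b z * a)
    {z : Fin n} {t ε : ℝ} (ht1 : t ≤ 1) (hε : 0 < ε) (hεt : ε < t)
    (hfreq : ∃ᶠ a in atTop, t * a ≤ c a z) :
    (matPD M γ).mulVec (fun z' => (b z' * (1 - t) + 2 * ε) ^ (-γ)) z ≤ (t - ε) ^ (-γ) := by
  obtain ⟨a, ha, hta⟩ := exists_seq_forall_of_frequently
    (hfreq.and_eventually (eventually_gt_atTop 0))
  have ha0 : ∀ k, 0 < a k := fun k => (hta k).2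
  have hd0 : ∀ z', 0 < b z' * (1 - t) + 2 * ε := fun z' => by
    have := mul_nonneg (hb z') (sub_nonneg.2 ht1)
    linarith
  have hmpos : ∀ k, 0 < marginal u (a k) := fun k => hu.marginal_pos _ (ha0 k)
  obtain ⟨A₀, hA₀0, hA₀⟩ : ∃ A₀, 0 < A₀ ∧ ∀ z', ∀ w, 0 ≤ w → c w z' ≤ b z' * w + A₀ := by
    obtain ⟨A₀, h⟩ := ((eventually_all.2 hev).and (eventually_gt_atTop 0)).exists_forall_of_atTop
    refine ⟨A₀, (h A₀ le_rfl).2, fun z' w hw => ?_⟩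
    rcases le_total A₀ w with h1 | h1
    · linarith [(h w h1).1 z', (h A₀ le_rfl).2]
    · linarith [hc.le_self w hw z', mul_nonneg (hb z') hw]
  set g : ℕ → Shock n E₁ E₂ E₃ → ℝ := fun k s =>
    marginal u (M.nextC c (a k) z s + M.R s.1 s.2.2.1 * (ε * a k)) with hg
  have hgm : ∀ k, Measurable (g k) := fun k => measurable_marginal.comp
    ((hc.measurable_nextC (a k) z).add (M.measurable_R_shock.mul_const _))
  have hpt : ∀ s : Shock n E₁ E₂ E₃,
      ENNReal.ofReal (M.varβRγ γ s.1 s.2 * (b s.1 * (1 - t) + 2 * ε) ^ (-γ))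
      ≤ liminf (fun k => ENNReal.ofReal (M.varβR s.1 s.2 * (g k s / marginal u (a k)))) atTop := by
    intro s
    rcases (M.R_nonneg s.1 s.2.2.1).eq_or_lt with hR | hR
    · simp [Model.varβRγ, ← hR]
    have hpos : 0 < M.R s.1 s.2.2.1 * (b s.1 * (1 - t) + 2 * ε) := mul_pos hR (hd0 s.1)
    have hlim := (((hrv.tendsto _ hpos).comp ha).const_mul (M.varβR s.1 s.2))
    rw [varβR_mul_rpow (hd0 s.1).le] at hlim
    rw [← (ENNReal.tendsto_ofReal hlim).liminf_eq]
    refine liminf_le_liminf ?_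
    filter_upwards [(ha.const_mul_atTop (mul_pos hR hε)).eventually_ge_atTop
      (b s.1 * M.Y s.1 s.2.2.2 + A₀)] with k hk
    refine ENNReal.ofReal_le_ofReal (mul_le_mul_of_nonneg_left ?_ (varβR_nonneg _ _))
    refine div_le_div_of_nonneg_right ?_ (hmpos k).le
    have hs : 0 ≤ a k - c (a k) z := by linarith [hc.le_self (a k) (ha0 k).le z]
    have hY := M.Y_nonneg s.1 s.2.2.2
    have hC0 := hc.nextC_nonneg (ha0 k).le z s
    refine hu.marginal_anti
      (add_pos_of_nonneg_of_pos hC0 (mul_pos hR (mul_pos hε (ha0 k)))) ?_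
    have h1 : M.nextC c (a k) z s
        ≤ b s.1 * (M.R s.1 s.2.2.1 * (a k - c (a k) z) + M.Y s.1 s.2.2.2) + A₀ :=
      hA₀ _ _ (by positivity)
    have h2 : b s.1 * (M.R s.1 s.2.2.1 * (a k - c (a k) z))
        ≤ b s.1 * (M.R s.1 s.2.2.1 * ((1 - t) * a k)) := by
      have := (hta k).1
      have := hb s.1
      gcongr
      linarith
    have h3 : M.R s.1 s.2.2.1 * ε * a k = M.R s.1 s.2.2.1 * (ε * a k) := by ring
    nlinarith
  have hstep : ∀ k, ∫⁻ ω, ENNReal.ofReal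
      (M.varβR (ω 1).1 (ω 1).2 * (g k (ω 1) / marginal u (a k))) ∂(M.law z)
      ≤ ENNReal.ofReal (marginal u ((t - ε) * a k) / marginal u (a k)) := fun k => by
    rw [sum_lintegral_div_eq z (hgm k) (hmpos k), ENNReal.ofReal_div_of_pos (hmpos k)]
    refine ENNReal.div_le_div_right ?_ _
    have hta' := (hta k).1
    have hεa : ε * a k < t * a k := mul_lt_mul_of_pos_right hεt (ha0 k)
    refine (hc.euler_save hu hM (ha0 k) (z := z) (mul_pos hε (ha0 k)) (by linarith)).trans ?_
    refine ENNReal.ofReal_le_ofReal (hu.marginal_anti (mul_pos (by linarith) (ha0 k)) ?_)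
    linarith
  have hup : Tendsto (fun k => ENNReal.ofReal (marginal u ((t - ε) * a k) / marginal u (a k)))
      atTop (𝓝 (ENNReal.ofReal ((t - ε) ^ (-γ)))) :=
    ENNReal.tendsto_ofReal ((hrv.tendsto _ (by linarith)).comp ha)
  have hmain : ENNReal.ofReal
      ((matPD M γ).mulVec (fun z' => (b z' * (1 - t) + 2 * ε) ^ (-γ)) z)
      ≤ ENNReal.ofReal ((t - ε) ^ (-γ)) := by
    rw [← lintegral_law_varβRγ (d := fun z' => (b z' * (1 - t) + 2 * ε) ^ (-γ)) hint z
      (fun z' => Real.rpow_nonneg (hd0 z').le _), ← hup.liminf_eq]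
    calc ∫⁻ ω, ENNReal.ofReal (M.varβRγ γ (ω 1).1 (ω 1).2 *
          (b (ω 1).1 * (1 - t) + 2 * ε) ^ (-γ)) ∂(M.law z)
        ≤ ∫⁻ ω, liminf (fun k => ENNReal.ofReal
          (M.varβR (ω 1).1 (ω 1).2 * (g k (ω 1) / marginal u (a k)))) atTop ∂(M.law z) :=
          lintegral_mono fun ω => hpt (ω 1)
      _ ≤ liminf (fun k => ∫⁻ ω, ENNReal.ofReal
          (M.varβR (ω 1).1 (ω 1).2 * (g k (ω 1) / marginal u (a k))) ∂(M.law z)) atTop :=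
          lintegral_liminf_le fun k => measurable_varβR_mul (hgm k) _
      _ ≤ _ := liminf_le_liminf (Eventually.of_forall hstep)
  exact (ENNReal.ofReal_le_ofReal_iff (Real.rpow_nonneg (by linarith) _)).1 hmain

lemma le_mulVec_of_frequently_le (hu : IsInadaUtility u)
    (hM : SpectralConditions M u) (hrv : IsRegularlyVarying (marginal u) (-γ))
    (hR : ReturnZeroOrBoundedBelow M)
    (hint : ∀ z, M.FiniteMean (M.varβRγ γ) z) (hc : M.IsConsumptionFunction u c)
    {b : Fin n → ℝ} (hb : ∀ z, 0 < b z) (hev : ∀ z, ∀ᶠ a in atTop, b z * a ≤ c a z)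
    {z : Fin n} {t ε : ℝ} (ht0 : 0 ≤ t) (hε : 0 < ε) (hεt : t + ε ≤ 1)
    (hεb : ∀ z', ε < b z' * (1 - t)) (hfreq : ∃ᶠ a in atTop, c a z ≤ t * a) :
    (t + ε) ^ (-γ) ≤ (matPD M γ).mulVec (fun z' => (b z' * (1 - t) - ε) ^ (-γ)) z := by
  obtain ⟨δ, hδ, hR⟩ := hR
  obtain ⟨a, ha, hta⟩ := exists_seq_forall_of_frequently
    (hfreq.and_eventually (eventually_gt_atTop 0))
  have ha0 : ∀ k, 0 < a k := fun k => (hta k).2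
  have hmpos : ∀ k, 0 < marginal u (a k) := fun k => hu.marginal_pos _ (ha0 k)
  obtain ⟨μ, hμ0, hμ⟩ : ∃ μ, 0 < μ ∧ ∀ z', μ ≤ b z' * (1 - t) - ε := by
    have : Nonempty (Fin n) := ⟨z⟩
    obtain ⟨i, hi⟩ := Finite.exists_min fun z' => b z' * (1 - t) - ε
    exact ⟨_, sub_pos.2 (hεb i), hi⟩
  have hd0 : ∀ z', 0 < b z' * (1 - t) - ε := fun z' => sub_pos.2 (hεb z')
  obtain ⟨A₀, hA₀⟩ := (eventually_all.2 hev).exists_forall_of_atTop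
  have hlarge : ∀ᶠ k in atTop, A₀ ≤ δ * (1 - t) * a k :=
    (ha.const_mul_atTop (mul_pos hδ (by linarith))).eventually_ge_atTop A₀
  set g : ℕ → Shock n E₁ E₂ E₃ → ℝ := fun k s =>
    marginal u (M.R s.1 s.2.2.1 * (b s.1 * (1 - t) - ε) * a k) with hg
  have hbm : Measurable fun s : Shock n E₁ E₂ E₃ => b s.1 * (1 - t) - ε :=
    (measurable_of_finite fun z' => b z' * (1 - t) - ε).comp measurable_fst
  have hgm : ∀ k, Measurable (g k) := fun k => measurable_marginal.comp
    ((M.measurable_R_shock.mul hbm).mul_const _)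
  have hae : ∀ᵐ ω ∂(M.law z), M.R (ω 1).1 (ω 1).2.2.1 = 0 ∨ δ ≤ M.R (ω 1).1 (ω 1).2.2.1 :=
    Model.ae_law_one z (S := {s | M.R s.1 s.2.2.1 = 0 ∨ δ ≤ M.R s.1 s.2.2.1})
      ((M.measurable_R_shock (measurableSet_singleton 0)).union
        (measurableSet_le measurable_const M.measurable_R_shock)) (ae_return hR)
  have hcons : ∀ k, A₀ ≤ δ * (1 - t) * a k → ∀ s : Shock n E₁ E₂ E₃, δ ≤ M.R s.1 s.2.2.1 →
      M.R s.1 s.2.2.1 * (b s.1 * (1 - t) - ε) * a k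
        ≤ M.nextC c (a k) z s - M.R s.1 s.2.2.1 * (ε * a k) := fun k hk s hs => by
    have hsav : (1 - t) * a k ≤ a k - c (a k) z := by linarith [(hta k).1]
    have hsav0 : 0 ≤ (1 - t) * a k := mul_nonneg (by linarith) (ha0 k).le
    have h1 : M.R s.1 s.2.2.1 * ((1 - t) * a k)
        ≤ M.R s.1 s.2.2.1 * (a k - c (a k) z) + M.Y s.1 s.2.2.2 := by
      have := mul_le_mul_of_nonneg_left hsav (M.R_nonneg s.1 s.2.2.1)
      linarith [M.Y_nonneg s.1 s.2.2.2]
    have h2 : A₀ ≤ M.R s.1 s.2.2.1 * ((1 - t) * a k) := by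
      have := mul_le_mul_of_nonneg_right hs hsav0
      linarith
    have h3 := hA₀ _ (h2.trans h1) s.1
    have h4 := mul_le_mul_of_nonneg_left h1 (hb s.1).le
    have h5 : b s.1 * (M.R s.1 s.2.2.1 * ((1 - t) * a k)) ≤ M.nextC c (a k) z s := h4.trans h3
    linarith
  have hstep : ∀ᶠ k in atTop, ENNReal.ofReal (marginal u ((t + ε) * a k) / marginal u (a k))
      ≤ ∫⁻ ω, ENNReal.ofReal
        (M.varβR (ω 1).1 (ω 1).2 * (g k (ω 1) / marginal u (a k))) ∂(M.law z) := by
    filter_upwards [hlarge] with k hk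
    rw [sum_lintegral_div_eq z (hgm k) (hmpos k), ENNReal.ofReal_div_of_pos (hmpos k)]
    refine ENNReal.div_le_div_right ?_ _
    have hck := (hta k).1
    have hc0 := hc.nonneg (a k) (ha0 k).le z
    have hεa : 0 < ε * a k := mul_pos hε (ha0 k)
    have hsum : (t + ε) * a k ≤ 1 * a k := mul_le_mul_of_nonneg_right hεt (ha0 k).le
    have hm0 : 0 < δ * μ * a k := mul_pos (mul_pos hδ hμ0) (ha0 k)
    have heul := hc.euler_dissave hu hM (ha0 k) (z := z) hεa (by linarith) hm0 fun z' => by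
      filter_upwards [ae_return hR z'] with e he
      refine he.imp id fun h => le_trans ?_ (hcons k hk (z', e) h)
      have : δ * μ ≤ M.R z' e.2.1 * (b z' * (1 - t) - ε) :=
        mul_le_mul h (hμ z') hμ0.le (M.R_nonneg _ _)
      exact mul_le_mul_of_nonneg_right this (ha0 k).le
    refine (ENNReal.ofReal_le_ofReal
      (hu.marginal_anti (by linarith) (by linarith))).trans (heul.trans ?_)
    refine Finset.sum_le_sum fun z' _ => mul_le_mul_right (lintegral_mono_ae ?_) _
    filter_upwards [ae_return hR z'] with e he
    refine ENNReal.ofReal_le_ofReal ?_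
    rcases he with h | h
    · simp [Model.varβR, h]
    · refine mul_le_mul_of_nonneg_left (hu.marginal_anti ?_ (hcons k hk (z', e) h))
        (varβR_nonneg _ _)
      exact mul_pos (mul_pos (hδ.trans_le h) (hd0 z')) (ha0 k)
  have hbound : ∀ᶠ k in atTop, ∀ᵐ ω ∂(M.law z), ENNReal.ofReal
      (M.varβR (ω 1).1 (ω 1).2 * (g k (ω 1) / marginal u (a k)))
      ≤ ENNReal.ofReal (M.varβR (ω 1).1 (ω 1).2 * ((δ * μ) ^ (-γ) + 1)) := by
    have hδμ : 0 < δ * μ := mul_pos hδ hμ0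
    filter_upwards [((hrv.tendsto _ hδμ).comp ha).eventually_le_const
      (lt_add_one ((δ * μ) ^ (-γ)))] with k hk
    filter_upwards [hae] with ω hω
    refine ENNReal.ofReal_le_ofReal ?_
    rcases hω with h | h
    · simp [Model.varβR, h]
    · refine mul_le_mul_of_nonneg_left (le_trans ?_ hk) (varβR_nonneg _ _)
      refine div_le_div_of_nonneg_right (hu.marginal_anti (mul_pos hδμ (ha0 k)) ?_) (hmpos k).le
      have : δ * μ ≤ M.R (ω 1).1 (ω 1).2.2.1 * (b (ω 1).1 * (1 - t) - ε) :=
        mul_le_mul h (hμ _) hμ0.le (M.R_nonneg _ _)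
      exact mul_le_mul_of_nonneg_right this (ha0 k).le
  have hpt : ∀ ω : Path n E₁ E₂ E₃, Tendsto (fun k => ENNReal.ofReal
      (M.varβR (ω 1).1 (ω 1).2 * (g k (ω 1) / marginal u (a k)))) atTop
      (𝓝 (ENNReal.ofReal
        (M.varβRγ γ (ω 1).1 (ω 1).2 * (b (ω 1).1 * (1 - t) - ε) ^ (-γ)))) := fun ω => by
    rcases (M.R_nonneg (ω 1).1 (ω 1).2.2.1).eq_or_lt with h | h
    · simp [Model.varβRγ, Model.varβR, ← h]
    · refine ENNReal.tendsto_ofReal ?_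
      rw [← varβR_mul_rpow (hd0 _).le]
      exact ((hrv.tendsto _ (mul_pos h (hd0 _))).comp ha).const_mul _
  have hlim := tendsto_lintegral_filter_of_dominated_convergence
    (fun ω : Path n E₁ E₂ E₃ =>
      ENNReal.ofReal (M.varβR (ω 1).1 (ω 1).2 * ((δ * μ) ^ (-γ) + 1)))
    (Eventually.of_forall fun k => measurable_varβR_mul (hgm k) (marginal u (a k)))
    hbound ?_ (ae_of_all (M.law z) hpt)
  · rw [lintegral_law_varβRγ (d := fun z' => (b z' * (1 - t) - ε) ^ (-γ)) hint z
      (fun z' => Real.rpow_nonneg (hd0 z').le _)] at hlim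
    have hlow : Tendsto (fun k => ENNReal.ofReal (marginal u ((t + ε) * a k) / marginal u (a k)))
        atTop (𝓝 (ENNReal.ofReal ((t + ε) ^ (-γ)))) :=
      ENNReal.tendsto_ofReal ((hrv.tendsto _ (by linarith)).comp ha)
    have hmain := le_of_tendsto_of_tendsto hlow hlim hstep
    exact (ENNReal.ofReal_le_ofReal_iff (mulVec_nonneg_of_nonneg matPD_nonneg
      (fun z' => Real.rpow_nonneg (hd0 z').le _) z)).1 hmain
  · rw [M.lintegral_law_one z (g := fun s => ENNReal.ofReal
      (M.varβR s.1 s.2 * ((δ * μ) ^ (-γ) + 1)))]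
    · exact ENNReal.sum_ne_top.2 fun z' _ => ENNReal.mul_ne_top ENNReal.ofReal_ne_top
        ((hM.finite_βR z').mul_const _).lintegral_lt_top.ne
    · exact (measurable_varβR_shock.mul_const _).ennreal_ofReal

end Asymptotics

section Scalar

lemma one_add_rpow_ratio (hγ : 0 < γ) {θ : ℝ} (h0 : 0 < θ) (h1 : θ ≤ 1) :
    aggr γ (((1 - θ) / θ) ^ γ) = θ ^ (-γ) := by
  have h2 : 0 ≤ (1 - θ) / θ := div_nonneg (by linarith) h0.le
  rw [aggr, ← Real.rpow_mul h2, mul_one_div_cancel hγ.ne', Real.rpow_one, Real.rpow_neg h0.le,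
    ← Real.inv_rpow h0.le]
  congr 1
  field_simp
  ring

lemma rpow_ratio_eq {θ : ℝ} (h0 : 0 < θ) (h1 : θ < 1) :
    ((1 - θ) / θ) ^ γ = θ ^ (-γ) * (1 - θ) ^ γ := by
  rw [Real.div_rpow (by linarith) h0.le, Real.rpow_neg h0.le, div_eq_mul_inv, mul_comm]

variable {A : Matrix (Fin n) (Fin n) ℝ}

lemma mulVec_mul_const (x : Fin n → ℝ) (r : ℝ) (z : Fin n) :
    A.mulVec (fun z' => x z' * r) z = A.mulVec x z * r := by
  simp only [Matrix.mulVec, dotProduct, Finset.sum_mul, mul_assoc]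

lemma tendsto_mulVec {x : ℝ → Fin n → ℝ} {y : Fin n → ℝ} {z : Fin n} {l : Filter ℝ}
    (h : ∀ z', A z z' ≠ 0 → Tendsto (fun ε => x ε z') l (𝓝 (y z'))) :
    Tendsto (fun ε => A.mulVec (x ε) z) l (𝓝 (A.mulVec y z)) := by
  simp only [Matrix.mulVec, dotProduct]
  refine tendsto_finsetSum _ fun z' _ => ?_
  rcases eq_or_ne (A z z') 0 with h0 | h0
  · simpa [h0] using tendsto_const_nhds
  · exact (h z' h0).const_mul _

/-- Passing to the limit `ε → 0` in the upper asymptotic inequality. -/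
lemma closed_and_aggr_le_of_perturbed (hγ : 0 < γ) (hA : ∀ i j, 0 ≤ A i j) {θ : Fin n → ℝ}
    (hθ0 : ∀ z, 0 ≤ θ z) {z : Fin n} (hz : 0 < θ z) (hz1 : θ z ≤ 1)
    (h : ∀ ε, 0 < ε → 2 * ε < θ z → A.mulVec
      (fun z' => ((θ z' + ε) * (1 - (θ z - ε)) + 2 * ε) ^ (-γ)) z ≤ (θ z - ε - ε) ^ (-γ)) :
    (∀ z', 0 < A z z' → 0 < θ z') ∧ aggr γ (A.mulVec (fun z' => θ z' ^ (-γ)) z) ≤ θ z ^ (-γ) := by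
  have hev : ∀ᶠ ε in 𝓝[>] (0 : ℝ), 0 < ε ∧ 2 * ε < θ z := by
    refine (eventually_mem_nhdsWithin).and (nhdsWithin_le_nhds ?_)
    filter_upwards [Iio_mem_nhds (show (0 : ℝ) < θ z / 2 by linarith)] with ε hε
    have : ε < θ z / 2 := hε
    linarith
  have hs0 : ∀ ε, 0 < ε → ∀ z', 0 < (θ z' + ε) * (1 - (θ z - ε)) + 2 * ε := fun ε hε z' => by
    have := hθ0 z'
    have : 0 ≤ (θ z' + ε) * (1 - (θ z - ε)) := mul_nonneg (by linarith) (by linarith)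
    linarith
  have hs : ∀ z', Tendsto (fun ε => (θ z' + ε) * (1 - (θ z - ε)) + 2 * ε) (𝓝[>] (0 : ℝ))
      (𝓝 (θ z' * (1 - θ z))) := fun z' => by
    have : Continuous fun ε => (θ z' + ε) * (1 - (θ z - ε)) + 2 * ε := by fun_prop
    have h1 := (this.tendsto 0).mono_left (nhdsWithin_le_nhds (s := Set.Ioi 0))
    simpa using h1
  have hr : Tendsto (fun ε => θ z - ε - ε) (𝓝[>] (0 : ℝ)) (𝓝 (θ z)) := by
    have : Continuous fun ε => θ z - ε - ε := by fun_prop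
    have h1 := (this.tendsto 0).mono_left (nhdsWithin_le_nhds (s := Set.Ioi 0))
    simpa using h1
  have hpos : ∀ z', 0 < A z z' → 0 < θ z' * (1 - θ z) := fun z' hAz => by
    have h1 : ∀ᶠ ε in 𝓝[>] (0 : ℝ),
        A z z' * (θ z - ε - ε) ^ γ ≤ ((θ z' + ε) * (1 - (θ z - ε)) + 2 * ε) ^ γ := by
      filter_upwards [hev] with ε ⟨hε, hε2⟩
      have h2 : A z z' * ((θ z' + ε) * (1 - (θ z - ε)) + 2 * ε) ^ (-γ)
          ≤ (θ z - ε - ε) ^ (-γ) := by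
        refine le_trans ?_ (h ε hε hε2)
        rw [Matrix.mulVec, dotProduct]
        exact Finset.single_le_sum
          (f := fun z' => A z z' * ((θ z' + ε) * (1 - (θ z - ε)) + 2 * ε) ^ (-γ))
          (fun z'' _ => mul_nonneg (hA z z'') (Real.rpow_nonneg (hs0 ε hε z'').le _))
          (Finset.mem_univ z')
      have hr0 : 0 < θ z - ε - ε := by linarith
      rw [Real.rpow_neg (hs0 ε hε z').le, Real.rpow_neg hr0.le, ← div_eq_mul_inv,
        div_le_iff₀ (Real.rpow_pos_of_pos (hs0 ε hε z') _), inv_mul_eq_div,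
        le_div_iff₀ (Real.rpow_pos_of_pos hr0 _)] at h2
      exact h2
    have h3 := le_of_tendsto_of_tendsto ((hr.rpow_const (Or.inr hγ.le)).const_mul (A z z'))
      ((hs z').rpow_const (Or.inr hγ.le)) h1
    have h4 : 0 < (θ z' * (1 - θ z)) ^ γ :=
      (mul_pos hAz (Real.rpow_pos_of_pos hz γ)).trans_le h3
    have h5 : 0 ≤ θ z' * (1 - θ z) := mul_nonneg (hθ0 z') (by linarith)
    refine lt_of_le_of_ne h5 fun h6 => ?_
    rw [← h6, Real.zero_rpow hγ.ne'] at h4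
    exact lt_irrefl _ h4
  refine ⟨fun z' hAz => ?_, ?_⟩
  · exact pos_of_mul_pos_left (hpos z' hAz) (by linarith)
  have hx0 : 0 ≤ A.mulVec (fun z' => θ z' ^ (-γ)) z :=
    mulVec_nonneg_of_nonneg hA (fun z' => Real.rpow_nonneg (hθ0 z') _) z
  rw [← one_add_rpow_ratio hγ hz hz1]
  refine aggr_mono hγ hx0 ?_
  rcases hz1.eq_or_lt with h1 | h1
  · have : A.mulVec (fun z' => θ z' ^ (-γ)) z = 0 := by
      rw [Matrix.mulVec, dotProduct]
      refine Finset.sum_eq_zero fun z' _ => ?_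
      rcases (hA z z').eq_or_lt with h2 | h2
      · simp [← h2]
      · have := hpos z' h2
        simp [h1] at this
    rw [this]
    exact Real.rpow_nonneg (div_nonneg (by linarith) hz.le) _
  · have hlim := le_of_tendsto_of_tendsto
      (tendsto_mulVec (A := A) (z := z) (y := fun z' => (θ z' * (1 - θ z)) ^ (-γ)) fun z' hne =>
        (hs z').rpow_const (Or.inl (hpos z' (lt_of_le_of_ne (hA z z') hne.symm)).ne'))
      (hr.rpow_const (p := -γ) (Or.inl hz.ne'))
      (hev.mono fun ε hε => h ε hε.1 hε.2)
    have h1' : 0 < 1 - θ z := by linarith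
    simp only [Real.mul_rpow (hθ0 _) h1'.le] at hlim
    rw [mulVec_mul_const, Real.rpow_neg h1'.le, ← div_eq_mul_inv,
      div_le_iff₀ (Real.rpow_pos_of_pos h1' _)] at hlim
    rw [rpow_ratio_eq hz h1]
    exact hlim

/-- Passing to the limit `ε → 0` in the lower asymptotic inequality. -/
lemma le_aggr_of_perturbed (hγ : 0 < γ) (hA : ∀ i j, 0 ≤ A i j) {θ : Fin n → ℝ}
    (hθ0 : ∀ z, 0 < θ z) {z : Fin n} (hz1 : θ z ≤ 1)
    (h : ∀ ε, 0 < ε → θ z + ε + ε ≤ 1 → (∀ z', ε < θ z') →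
      (∀ z', ε < (θ z' - ε) * (1 - (θ z + ε))) → (θ z + ε + ε) ^ (-γ) ≤ A.mulVec
      (fun z' => ((θ z' - ε) * (1 - (θ z + ε)) - ε) ^ (-γ)) z) :
    θ z ^ (-γ) ≤ aggr γ (A.mulVec (fun z' => θ z' ^ (-γ)) z) := by
  rw [← one_add_rpow_ratio hγ (hθ0 z) hz1]
  refine aggr_mono hγ
    (Real.rpow_nonneg (div_nonneg (by linarith) (hθ0 z).le) _) ?_
  rcases hz1.eq_or_lt with h1 | h1
  · rw [h1, sub_self, zero_div, Real.zero_rpow hγ.ne']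
    exact mulVec_nonneg_of_nonneg hA (fun z' => Real.rpow_nonneg (hθ0 z').le _) z
  have h1' : 0 < 1 - θ z := by linarith
  have hs : ∀ z', Tendsto (fun ε => (θ z' - ε) * (1 - (θ z + ε)) - ε) (𝓝[>] (0 : ℝ))
      (𝓝 (θ z' * (1 - θ z))) := fun z' => by
    have : Continuous fun ε => (θ z' - ε) * (1 - (θ z + ε)) - ε := by fun_prop
    have h1 := (this.tendsto 0).mono_left (nhdsWithin_le_nhds (s := Set.Ioi 0))
    simpa using h1
  have hr : Tendsto (fun ε => θ z + ε + ε) (𝓝[>] (0 : ℝ)) (𝓝 (θ z)) := by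
    have : Continuous fun ε => θ z + ε + ε := by fun_prop
    have h1 := (this.tendsto 0).mono_left (nhdsWithin_le_nhds (s := Set.Ioi 0))
    simpa using h1
  have hid : Tendsto (fun ε : ℝ => ε) (𝓝[>] (0 : ℝ)) (𝓝 0) := nhdsWithin_le_nhds
  have hlim := le_of_tendsto_of_tendsto (hr.rpow_const (p := -γ) (Or.inl (hθ0 z).ne'))
    (tendsto_mulVec (A := A) (z := z) (y := fun z' => (θ z' * (1 - θ z)) ^ (-γ)) fun z' _ =>
      (hs z').rpow_const (Or.inl (mul_pos (hθ0 z') h1').ne'))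
    (by
      filter_upwards [eventually_mem_nhdsWithin (a := (0 : ℝ)) (s := Set.Ioi 0),
        hr.eventually_le_const h1, eventually_all.2 fun z' => hid.eventually_lt_const (hθ0 z'),
        eventually_all.2 fun z' => (hs z').eventually_const_lt (mul_pos (hθ0 z') h1')]
        with ε e1 e2 e3 e4
      exact h ε e1 e2 e3 fun z' => by linarith [e4 z'])
  simp only [Real.mul_rpow (hθ0 _).le h1'.le] at hlim
  rw [mulVec_mul_const, Real.rpow_neg h1'.le, ← div_eq_mul_inv,
    le_div_iff₀ (Real.rpow_pos_of_pos h1' _)] at hlim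
  rw [rpow_ratio_eq (hθ0 z) h1]
  exact hlim

end Scalar

section Ratio

lemma Model.IsConsumptionFunction.eventually_ratio_mem (hc : M.IsConsumptionFunction u c)
    (z : Fin n) : ∀ᶠ a in atTop, c a z / a ∈ Set.Icc (0 : ℝ) 1 := by
  filter_upwards [eventually_gt_atTop 0] with a ha
  exact ⟨div_nonneg (hc.nonneg a ha.le z) ha.le, (div_le_one ha).2 (hc.le_self a ha.le z)⟩

lemma Model.IsConsumptionFunction.isBoundedUnder_le (hc : M.IsConsumptionFunction u c)
    (z : Fin n) : IsBoundedUnder (· ≤ ·) atTop fun a => c a z / a :=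
  isBoundedUnder_of_eventually_le ((hc.eventually_ratio_mem z).mono fun _ h => h.2)

lemma Model.IsConsumptionFunction.isBoundedUnder_ge (hc : M.IsConsumptionFunction u c)
    (z : Fin n) : IsBoundedUnder (· ≥ ·) atTop fun a => c a z / a :=
  isBoundedUnder_of_eventually_ge ((hc.eventually_ratio_mem z).mono fun _ h => h.1)

lemma Model.IsConsumptionFunction.liminf_nonneg (hc : M.IsConsumptionFunction u c) (z : Fin n) :
    0 ≤ liminf (fun a => c a z / a) atTop :=
  le_liminf_of_le (hc.isBoundedUnder_le z).isCoboundedUnder_ge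
    ((hc.eventually_ratio_mem z).mono fun _ h => h.1)

lemma Model.IsConsumptionFunction.limsup_le_one (hc : M.IsConsumptionFunction u c) (z : Fin n) :
    limsup (fun a => c a z / a) atTop ≤ 1 :=
  limsup_le_of_le (hc.isBoundedUnder_ge z).isCoboundedUnder_le
    ((hc.eventually_ratio_mem z).mono fun _ h => h.2)

lemma Model.IsConsumptionFunction.liminf_le_limsup (hc : M.IsConsumptionFunction u c)
    (z : Fin n) :
    liminf (fun a => c a z / a) atTop ≤ limsup (fun a => c a z / a) atTop :=
  Filter.liminf_le_limsup (hc.isBoundedUnder_le z) (hc.isBoundedUnder_ge z)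

/-- The upper asymptotic propensities to consume form a supersolution on the closed class of
states where they are positive. -/
lemma limsup_supersolution (hγ : 0 < γ) (hu : IsInadaUtility u)
    (hM : SpectralConditions M u) (hrv : IsRegularlyVarying (marginal u) (-γ))
    (hint : ∀ z, M.FiniteMean (M.varβRγ γ) z) (hc : M.IsConsumptionFunction u c)
    {θ : Fin n → ℝ} (hθ : θ = fun z => limsup (fun a => c a z / a) atTop) {z : Fin n}
    (hz : 0 < θ z) :
    (∀ z', 0 < matPD M γ z z' → 0 < θ z') ∧
      aggr γ ((matPD M γ).mulVec (fun z' => θ z' ^ (-γ)) z) ≤ θ z ^ (-γ) := by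
  have hθ0 : ∀ z, 0 ≤ θ z := fun z => by
    rw [hθ]
    exact (hc.liminf_nonneg z).trans (hc.liminf_le_limsup z)
  have hθ1 : ∀ z, θ z ≤ 1 := fun z => by
    rw [hθ]
    exact hc.limsup_le_one z
  refine closed_and_aggr_le_of_perturbed hγ matPD_nonneg hθ0 hz (hθ1 z) fun ε hε hε2 => ?_
  refine mulVec_le_of_frequently_ge hu hM hrv hint hc (fun z' => by linarith [hθ0 z'])
    (fun z' => ?_) (by linarith [hθ1 z]) hε (by linarith) ?_
  · have h := eventually_lt_of_limsup_lt (u := fun a => c a z' / a) (f := atTop)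
      (b := θ z' + ε) (by rw [hθ]; linarith) (hc.isBoundedUnder_le z')
    filter_upwards [h, eventually_gt_atTop 0] with a h1 h2
    exact ((div_lt_iff₀ h2).1 h1).le
  · have h := frequently_lt_of_lt_limsup (u := fun a => c a z / a) (f := atTop)
      (b := θ z - ε) (hc.isBoundedUnder_ge z).isCoboundedUnder_le (by rw [hθ]; linarith)
    refine (h.and_eventually (eventually_gt_atTop 0)).mono fun a ⟨h1, h2⟩ => ?_
    exact ((lt_div_iff₀ h2).1 h1).le

/-- Positive lower asymptotic propensities to consume form a subsolution. -/
lemma liminf_subsolution (hγ : 0 < γ) (hu : IsInadaUtility u)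
    (hM : SpectralConditions M u) (hrv : IsRegularlyVarying (marginal u) (-γ))
    (hR : ReturnZeroOrBoundedBelow M)
    (hint : ∀ z, M.FiniteMean (M.varβRγ γ) z) (hc : M.IsConsumptionFunction u c)
    {θ : Fin n → ℝ} (hθ : θ = fun z => liminf (fun a => c a z / a) atTop)
    (hθ0 : ∀ z, 0 < θ z) (z : Fin n) :
    θ z ^ (-γ) ≤ aggr γ ((matPD M γ).mulVec (fun z' => θ z' ^ (-γ)) z) := by
  have hθ1 : θ z ≤ 1 := by
    rw [hθ]
    exact (hc.liminf_le_limsup z).trans (hc.limsup_le_one z)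
  refine le_aggr_of_perturbed hγ matPD_nonneg hθ0 hθ1 fun ε hε hε1 hε2 hε3 => ?_
  refine le_mulVec_of_frequently_le hu hM hrv hR hint hc (fun z' => sub_pos.2 (hε2 z'))
    (fun z' => ?_) (by linarith [hθ0 z]) hε hε1 hε3 ?_
  · have h := eventually_lt_of_lt_liminf (u := fun a => c a z' / a) (f := atTop)
      (b := θ z' - ε) (by rw [hθ]; linarith) (hc.isBoundedUnder_ge z')
    filter_upwards [h, eventually_gt_atTop 0] with a h1 h2
    exact ((lt_div_iff₀ h2).1 h1).le
  · have h := frequently_lt_of_liminf_lt (u := fun a => c a z / a) (f := atTop)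
      (b := θ z + ε) (hc.isBoundedUnder_le z).isCoboundedUnder_ge (by rw [hθ]; linarith)
    refine (h.and_eventually (eventually_gt_atTop 0)).mono fun a ⟨h1, h2⟩ => ?_
    exact ((div_lt_iff₀ h2).1 h1).le

lemma le_rpow_neg_iff (hγ : 0 < γ) {θ x : ℝ} (hθ : 0 < θ) (hx : 0 < x) :
    (x ≤ θ ^ (-γ) ↔ θ ≤ x ^ (-1 / γ)) ∧ (θ ^ (-γ) ≤ x ↔ x ^ (-1 / γ) ≤ θ) := by
  have h : θ = (θ ^ (-γ)) ^ (-1 / γ) := by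
    rw [← Real.rpow_mul hθ.le, neg_mul, mul_div_cancel₀ _ hγ.ne', neg_neg, Real.rpow_one]
  have hp : 0 < θ ^ (-γ) := Real.rpow_pos_of_pos hθ _
  have hneg : -1 / γ < 0 := div_neg_of_neg_of_pos (by norm_num) hγ
  constructor
  · conv_rhs => rw [h]
    exact (Real.rpow_le_rpow_iff_of_neg hp hx hneg).symm
  · conv_rhs => rw [h]
    exact (Real.rpow_le_rpow_iff_of_neg hx hp hneg).symm

end Ratio

lemma isFixedPointF_iff {x : Fin n → ℝ} : IsFixedPointF M γ x ↔
    (∀ z, 0 ≤ x z) ∧ ∀ z, aggr γ ((matPD M γ).mulVec x z) = x z :=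
  and_congr_right fun _ => funext_iff

end IncomeFluctuation

end
open IncomeFluctuation in
theorem theorem3p2 {n : ℕ} {E₁ E₂ E₃ : Type*}
    [MeasurableSpace E₁] [MeasurableSpace E₂] [MeasurableSpace E₃]
    (M : Model n E₁ E₂ E₃) (u : ℝ → EReal) (γ : ℝ) (hγ : 0 < γ)
    (hu : IsInadaUtility u)
    (hM : SpectralConditions M u)
    (hrv : IsRegularlyVarying (marginal u) (-γ))
    (hR : ReturnZeroOrBoundedBelow M) :
    (∀ z, M.FiniteMean (M.varβRγ γ) z) ∧
    ((∃ x, IsFixedPointF M γ x) ↔ specRad (matPD M γ) < 1) ∧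
    (∀ x y, IsFixedPointF M γ x → IsFixedPointF M γ y → x = y) ∧
    ∀ c : ℝ → Fin n → ℝ, M.IsConsumptionFunction u c →
      (specRad (matPD M γ) < 1 → ∀ x, IsFixedPointF M γ x →
        (∀ z, 0 ≤ liminf (fun a => c a z / a) atTop ∧
          liminf (fun a => c a z / a) atTop ≤ limsup (fun a => c a z / a) atTop ∧
          limsup (fun a => c a z / a) atTop ≤ x z ^ (-1 / γ)) ∧
        ((∀ z, 0 < liminf (fun a => c a z / a) atTop) →
          ∀ z, Tendsto (fun a => c a z / a) atTop (𝓝 (x z ^ (-1 / γ))) ∧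
            0 < x z ^ (-1 / γ) ∧ x z ^ (-1 / γ) ≤ 1)) ∧
      (1 ≤ specRad (matPD M γ) → (matPD M γ).IsIrreducible →
        ∀ z, Tendsto (fun a => c a z / a) atTop (𝓝 0)) := by
  have hint := finiteMean_varβRγ hγ hM.finite_βR hR
  have hA : ∀ i j, 0 ≤ matPD M γ i j := matPD_nonneg
  have hone : ∀ {x : Fin n → ℝ}, IsFixedPointF M γ x → ∀ z, 1 ≤ x z := fun {x} hx z => by
    rw [isFixedPointF_iff] at hx
    rw [← hx.2 z]
    exact one_le_aggr hγ (mulVec_nonneg_of_nonneg hA hx.1 z)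
  refine ⟨hint, ⟨fun ⟨x, hx⟩ => ?_, fun h => ?_⟩, fun x y hx hy => ?_, fun c hc => ⟨?_, ?_⟩⟩
  · exact specRad_lt_one_of_aggr_le hγ hA (fun z => zero_lt_one.trans_le (hone hx z))
      fun z => ((isFixedPointF_iff.1 hx).2 z).le
  · obtain ⟨x, hx⟩ := exists_aggr_fixedPoint hγ hA h
    exact ⟨x, isFixedPointF_iff.2 hx⟩
  · rw [isFixedPointF_iff] at hx hy
    funext z
    exact le_antisymm (le_of_le_aggr hγ hA hx.1 (fun i => (hx.2 i).ge) hy.1 hy.2 z)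
      (le_of_le_aggr hγ hA hy.1 (fun i => (hy.2 i).ge) hx.1 hx.2 z)
  · intro _ x hx
    have hx1 := hone hx
    have hx0 : ∀ z, 0 < x z := fun z => zero_lt_one.trans_le (hx1 z)
    have hx' := isFixedPointF_iff.1 hx
    have hupper : ∀ z, limsup (fun a => c a z / a) atTop ≤ x z ^ (-1 / γ) := fun z => by
      obtain ⟨θ, hθ⟩ : ∃ θ : Fin n → ℝ, θ = fun z => limsup (fun a => c a z / a) atTop :=
        ⟨_, rfl⟩
      rw [← congrFun hθ z]
      rcases le_or_gt (θ z) 0 with h | h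
      · exact h.trans (Real.rpow_nonneg (hx0 z).le _)
      · refine (le_rpow_neg_iff hγ h (hx0 z)).1.1 ?_
        exact le_of_aggr_le (x := fun z => θ z ^ (-γ)) (S := {z | 0 < θ z}) hγ hA
          (fun i hi => (limsup_supersolution hγ hu hM hrv hint hc hθ hi).1)
          (fun i hi => Real.rpow_pos_of_pos hi _)
          (fun i hi => (limsup_supersolution hγ hu hM hrv hint hc hθ hi).2) hx'.1 hx'.2 h
    refine ⟨fun z => ⟨hc.liminf_nonneg z, hc.liminf_le_limsup z, hupper z⟩, fun hpos z => ?_⟩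
    refine ⟨?_, Real.rpow_pos_of_pos (hx0 z) _,
      Real.rpow_le_one_of_one_le_of_nonpos (hx1 z)
        (div_nonpos_of_nonpos_of_nonneg (by norm_num) hγ.le)⟩
    refine tendsto_of_le_liminf_of_limsup_le ?_ (hupper z) (hc.isBoundedUnder_le z)
      (hc.isBoundedUnder_ge z)
    refine (le_rpow_neg_iff hγ (hpos z) (hx0 z)).2.1 ?_
    exact le_of_le_aggr (x := fun z => (liminf (fun a => c a z / a) atTop) ^ (-γ)) hγ hA
      (fun i => Real.rpow_nonneg (hpos i).le _)
      (liminf_subsolution hγ hu hM hrv hR hint hc rfl hpos) hx'.1 hx'.2 z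
  · intro hr hirr z
    obtain ⟨θ, hθ⟩ : ∃ θ : Fin n → ℝ, θ = fun z => limsup (fun a => c a z / a) atTop := ⟨_, rfl⟩
    have hzero : θ z ≤ 0 := by
      by_contra! hpos
      have hall : ∀ j, 0 < θ j := hirr.mem_of_closed (S := {z | 0 < θ z})
        (fun i hi => (limsup_supersolution hγ hu hM hrv hint hc hθ hi).1) hpos
      exact absurd (specRad_lt_one_of_aggr_le hγ hA (x := fun z => θ z ^ (-γ))
        (fun i => Real.rpow_pos_of_pos (hall i) _)
        fun i => (limsup_supersolution hγ hu hM hrv hint hc hθ (hall i)).2) (not_lt.2 hr)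
    rw [congrFun hθ z] at hzero
    exact tendsto_of_le_liminf_of_limsup_le (hc.liminf_nonneg z) hzero (hc.isBoundedUnder_le z)
      (hc.isBoundedUnder_ge z)
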